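/- Let $k\ge 2$ be fixed, and let $\boldsymbol Q^0$ be a fixed symmetric $k\times k$ matrix with positive entries and no two identical columns. Then there is a constant $C_{\boldsymbol Q^0}>0$, depending only on $\boldsymbol Q^0$, such that the following holds. Let $\alpha^0=(\alpha^0_1,\dots,\alpha^0_k)$ be a fixed vector with $\alpha^0_a>0$ for all $a$, $\sum_a\alpha^0_a=1$ and $\sum_{a,b}\alpha^0_a\alpha^0_b\boldsymbol Q^0_{ab}=1$. Let $(\rho_n)$ be a sequence of positive numbers with $\sup_n\max_{a,b}\rho_n\boldsymbol Q^0_{ab}<1$ (which holds in particular if $(\rho_n)$ is decreasing and all $\rho_n\boldsymbol Q^0_{ab}$ lie in $(0,1)$) and $\rho_n/(\log n/n)\to\infty$. For each $n$ let the network be drawn, and fully observed, from the stochastic block model with parameters $\alpha^*=\alpha^0$ and $\boldsymbol Q^*=\rho_n\boldsymbol Q^0$: the labels $z^*(1),\dots,z^*(n)\in\{1,\dots,k\}$ are i.i.d. with law $\alpha^0$, and, conditionally on $z^*$, the entries $\boldsymbol A_{ij}=\boldsymbol A_{ji}$, $i<j$, are independent Bernoulli variables with parameters $\boldsymbol Q^*_{z^*(i)z^*(j)}$,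 with $\boldsymbol A_{ii}=0$. Let $\boldsymbol\Theta^*_{ij}=\boldsymbol Q^*_{z^*(i)z^*(j)}$ for $i\ne j$ and $\boldsymbol\Theta^*_{ii}=0$. Let $\mathcal L(\boldsymbol A;z,\boldsymbol Q)=\sum_{i<j}\big(\boldsymbol A_{ij}\log \boldsymbol Q_{z(i)z(j)}+(1-\boldsymbol A_{ij})\log(1-\boldsymbol Q_{z(i)z(j)})\big)$ and $l(\boldsymbol A;\alpha,\boldsymbol Q)=\sum_{z}\big(\prod_i\alpha_{z(i)}\big)e^{\mathcal L(\boldsymbol A;z,\boldsymbol Q)}$, the sum being over all label functions $z:\{1,\dots,n\}\to\{1,\dots,k\}$. The maximum likelihood estimator $(\widehat{\boldsymbol Q},\widehat z)$ is a maximizer of $\mathcal L(\boldsymbol A;z,\boldsymbol Q)$ over all label functions $z$ and all symmetric $\boldsymbol Q\in(0,1)^{k\times k}$. The variational estimator $(\widehat\alpha^{VAR},\widehat{\boldsymbol Q}^{VAR},\widehat\tau^{VAR})$ is a maximizer of $$\log l(\boldsymbol A;\alpha,\boldsymbol Q)-\mathrm{KL}\big(\mathbb P_\tau\,\|\,\mathbb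 P(\cdot\mid \boldsymbol A,\alpha,\boldsymbol Q)\big)$$ over probability vectors $\alpha$ with positive entries, symmetric $\boldsymbol Q\in(0,1)^{k\times k}$ and families $\tau=(\tau^1,\dots,\tau^n)$ of probability vectors on $\{1,\dots,k\}$, where $\mathbb P_\tau(z)=\prod_i\tau^i_{z(i)}$ and $\mathbb P(z\mid \boldsymbol A,\alpha,\boldsymbol Q)=\prod_i\alpha_{z(i)}\,e^{\mathcal L(\boldsymbol A;z,\boldsymbol Q)}/l(\boldsymbol A;\alpha,\boldsymbol Q)$. Put $\widehat z^{VAR}(i)\in\arg\max_a(\widehat\tau^{VAR})^i_a$, let $\widehat{\boldsymbol Q}^{ML-VAR}_{ab}$ be the mean of $\boldsymbol A_{ij}$ over the ordered pairs $i\ne j$ with $\widehat z^{VAR}(i)=a$, $\widehat z^{VAR}(j)=b$, and let $\widehat{\boldsymbol\Theta}^{VAR}_{ij}=\widehat{\boldsymbol Q}^{ML-VAR}_{\widehat z^{VAR}(i)\widehat z^{VAR}(j)}$ for $i\ne j$, $\widehat{\boldsymbol\Theta}^{VAR}_{ii}=0$. Then, with probability tending to $1$ as $n\to\infty$, both label estimators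 exist and, for every choice of the maximizers, $\widehat z^{VAR}$ and $\widehat z$ are equal up to a permutation of $\{1,\dots,k\}$. Moreover, with probability tending to $1$ as $n\to\infty$, the variational estimator exists and, for every choice of the maximizers, $$\big\|\boldsymbol\Theta^*-\widehat{\boldsymbol\Theta}^{VAR}\big\|_2^2\le C_{\boldsymbol Q^0}\,\rho_n\,(k^2+n\log k),$$ where $\|\cdot\|_2$ is the Frobenius norm. -/

import Mathlib

open Filter Topology MeasureTheory ProbabilityTheory
open scoped BigOperators

namespace SBM

noncomputable section

/-- Unordered pairs of distinct nodes, represented as pairs `(i, j)` with `i < j`. -/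
abbrev NodePair (n : ℕ) : Type := {e : Fin n × Fin n // e.1 < e.2}

/-- Label functions with `n` nodes and `k` communities. -/
abbrev Labels (n k : ℕ) : Type := Fin n → Fin k

/-- A realization of the network: for each pair `i < j`, whether there is an edge. -/
abbrev Edges (n : ℕ) : Type := NodePair n → Bool

/-- The symmetric 0-1 adjacency matrix, with zero diagonal, of a network. -/
def adjacency {n : ℕ} (x : Edges n) : Matrix (Fin n) (Fin n) ℝ := fun i j =>
  if h : i < j then (if x ⟨(i, j), h⟩ then 1 else 0)
  else if h : j < i then (if x ⟨(j, i), h⟩ then 1 else 0)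
  else 0

/-! ### The stochastic block model with random labels -/

/-- The distribution on `k` labels that gives probability `α a` to the label `a`. -/
def labelLaw {k : ℕ} (α : Fin k → ℝ) : Measure (Fin k) :=
  ∑ a, ENNReal.ofReal (α a) • Measure.dirac a

/-- The Bernoulli distribution with parameter `q` (a parameter outside `[0, 1]` is projected
onto `[0, 1]`; this is not used for the parameters of a model). -/
def edgeLaw (q : ℝ) : Measure Bool :=
  bernoulliMeasure true false (Set.projIcc 0 1 zero_le_one q)

/-- Conditionally on the labels `z`, the edges are independent and the pair `i < j` is an edge
with probability `Q (z i) (z j)`. -/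
def edgesLaw {n k : ℕ} (Q : Matrix (Fin k) (Fin k) ℝ) (z : Labels n k) : Measure (Edges n) :=
  Measure.pi fun e : NodePair n => edgeLaw (Q (z e.1.1) (z e.1.2))

/-- The joint law of the labels and of the network: the labels are i.i.d. with law `α`, and
conditionally on the labels the edges are independent Bernoulli variables. -/
def sbmLaw (n : ℕ) {k : ℕ} (α : Fin k → ℝ) (Q : Matrix (Fin k) (Fin k) ℝ) :
    Measure (Labels n k × Edges n) :=
  (Measure.pi fun _ : Fin n => labelLaw α) ⊗ₘ
    (Kernel.ofFunOfCountable fun z => edgesLaw Q z)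

theorem isProbabilityMeasure_labelLaw {k : ℕ} {α : Fin k → ℝ} (h : α ∈ stdSimplex ℝ (Fin k)) :
    IsProbabilityMeasure (labelLaw α) := by
  constructor
  simp only [labelLaw, Measure.coe_finsetSum, Finset.sum_apply, Measure.smul_apply,
    measure_univ, smul_eq_mul, mul_one]
  rw [← ENNReal.ofReal_sum_of_nonneg fun a _ => h.1 a, h.2, ENNReal.ofReal_one]

instance (q : ℝ) : IsProbabilityMeasure (edgeLaw q) := by
  unfold edgeLaw; infer_instance

instance {n k : ℕ} (Q : Matrix (Fin k) (Fin k) ℝ) (z : Labels n k) :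
    IsProbabilityMeasure (edgesLaw Q z) := by
  unfold edgesLaw; infer_instance

theorem isProbabilityMeasure_sbmLaw (n : ℕ) {k : ℕ} {α : Fin k → ℝ}
    (h : α ∈ stdSimplex ℝ (Fin k)) (Q : Matrix (Fin k) (Fin k) ℝ) :
    IsProbabilityMeasure (sbmLaw n α Q) := by
  have := isProbabilityMeasure_labelLaw h
  have : IsMarkovKernel (Kernel.ofFunOfCountable fun z : Labels n k => edgesLaw Q z) :=
    ⟨fun z => inferInstanceAs (IsProbabilityMeasure (edgesLaw Q z))⟩
  unfold sbmLaw
  infer_instance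

/-! ### Parameter space and likelihoods -/

/-- Symmetric matrices of connection probabilities with entries in `(0, 1)`. -/
def connectionSpace (k : ℕ) : Set (Matrix (Fin k) (Fin k) ℝ) :=
  {Q | Q.IsSymm ∧ ∀ a b, 0 < Q a b ∧ Q a b < 1}

/-- Vectors of community proportions, all of them positive. -/
def proportionSpace (k : ℕ) : Set (Fin k → ℝ) :=
  {α | (∀ a, 0 < α a) ∧ ∑ a, α a = 1}

/-- Every parameter `(α, Q)` of the parameter space has the form `Q = r • Q₀` with `r > 0`, `Q₀`
symmetric with positive entries and `∑ a, ∑ b, α a * α b * Q₀ a b = 1`. -/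
theorem exists_scaling {k : ℕ} {α : Fin k → ℝ} {Q : Matrix (Fin k) (Fin k) ℝ}
    (hα : α ∈ proportionSpace k) (hQ : Q ∈ connectionSpace k) :
    ∃ (r : ℝ) (Q₀ : Matrix (Fin k) (Fin k) ℝ), 0 < r ∧ Q₀.IsSymm ∧ (∀ a b, 0 < Q₀ a b) ∧
      ∑ a, ∑ b, α a * α b * Q₀ a b = 1 ∧ Q = r • Q₀ := by
  have hne : (Finset.univ : Finset (Fin k)).Nonempty := by
    by_contra h
    rw [Finset.not_nonempty_iff_eq_empty] at h
    have := hα.2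
    simp [h] at this
  have hr : 0 < ∑ a, ∑ b, α a * α b * Q a b :=
    Finset.sum_pos (fun a _ => Finset.sum_pos
      (fun b _ => mul_pos (mul_pos (hα.1 a) (hα.1 b)) (hQ.2 a b).1) hne) hne
  refine ⟨_, (∑ a, ∑ b, α a * α b * Q a b)⁻¹ • Q, hr, hQ.1.smul _, fun a b => ?_, ?_, ?_⟩
  · simpa using mul_pos (inv_pos.2 hr) (hQ.2 a b).1
  · simp only [Matrix.smul_apply, smul_eq_mul, mul_left_comm _ (_⁻¹ : ℝ), ← Finset.mul_sum]
    exact inv_mul_cancel₀ hr.ne'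
  · rw [smul_smul, mul_inv_cancel₀ hr.ne', one_smul]

/-- The log-likelihood of `(z, Q)`, for the observed adjacency matrix `A`. -/
def logLik {n k : ℕ} (A : Matrix (Fin n) (Fin n) ℝ) (z : Labels n k)
    (Q : Matrix (Fin k) (Fin k) ℝ) : ℝ :=
  ∑ e : NodePair n, (A e.1.1 e.1.2 * Real.log (Q (z e.1.1) (z e.1.2))
    + (1 - A e.1.1 e.1.2) * Real.log (1 - Q (z e.1.1) (z e.1.2)))

/-- The likelihood of `(α, Q)` and the label function `z`. -/
def completeLik {n k : ℕ} (A : Matrix (Fin n) (Fin n) ℝ) (z : Labels n k)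
    (α : Fin k → ℝ) (Q : Matrix (Fin k) (Fin k) ℝ) : ℝ :=
  (∏ i, α (z i)) * Real.exp (logLik A z Q)

/-- The likelihood of `(α, Q)` in the model with random labels. -/
def lik {n k : ℕ} (A : Matrix (Fin n) (Fin n) ℝ)
    (α : Fin k → ℝ) (Q : Matrix (Fin k) (Fin k) ℝ) : ℝ :=
  ∑ z : Labels n k, completeLik A z α Q

/-- The posterior probability of the label function `z` given `A`. -/
def posterior {n k : ℕ} (A : Matrix (Fin n) (Fin n) ℝ)
    (α : Fin k → ℝ) (Q : Matrix (Fin k) (Fin k) ℝ) (z : Labels n k) : ℝ :=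
  completeLik A z α Q / lik A α Q

/-! ### The maximum likelihood estimator -/

/-- `(Q, z)` maximizes the log-likelihood over the parameter space. -/
def IsMLE {n k : ℕ} (A : Matrix (Fin n) (Fin n) ℝ)
    (Q : Matrix (Fin k) (Fin k) ℝ) (z : Labels n k) : Prop :=
  Q ∈ connectionSpace k ∧
    ∀ Q' ∈ connectionSpace k, ∀ z' : Labels n k, logLik A z' Q' ≤ logLik A z Q

/-- `z` is a maximum likelihood estimator of the labels. -/
def IsMLELabels {n k : ℕ} (A : Matrix (Fin n) (Fin n) ℝ) (z : Labels n k) : Prop :=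
  ∃ Q : Matrix (Fin k) (Fin k) ℝ, IsMLE A Q z

/-! ### The mean-field variational estimator -/

/-- Product distributions on label functions: `τ i` is the law of the label of node `i`. -/
def meanFieldSpace (n k : ℕ) : Set (Fin n → Fin k → ℝ) :=
  {τ | ∀ i, τ i ∈ stdSimplex ℝ (Fin k)}

/-- The probability of `z` under the product distribution with parameter `τ`. -/
def productProb {n k : ℕ} (τ : Fin n → Fin k → ℝ) (z : Labels n k) : ℝ :=
  ∏ i, τ i (z i)

/-- The Kullback-Leibler divergence `KL(p ‖ q)` on a finite set, with `0 log 0 = 0`; it is only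
used with `q` everywhere positive. -/
def KL {S : Type*} [Fintype S] (p q : S → ℝ) : ℝ :=
  ∑ s, p s * Real.log (p s / q s)

/-- The variational objective function. -/
def objective {n k : ℕ} (A : Matrix (Fin n) (Fin n) ℝ) (τ : Fin n → Fin k → ℝ)
    (α : Fin k → ℝ) (Q : Matrix (Fin k) (Fin k) ℝ) : ℝ :=
  Real.log (lik A α Q) - KL (productProb τ) (posterior A α Q)

/-- `(α, Q, τ)` maximizes the variational objective over the parameter spaces. -/
def IsVariational {n k : ℕ} (A : Matrix (Fin n) (Fin n) ℝ)
    (α : Fin k → ℝ) (Q : Matrix (Fin k) (Fin k) ℝ) (τ : Fin n → Fin k → ℝ) : Prop :=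
  α ∈ proportionSpace k ∧ Q ∈ connectionSpace k ∧ τ ∈ meanFieldSpace n k ∧
    ∀ α' ∈ proportionSpace k, ∀ Q' ∈ connectionSpace k, ∀ τ' ∈ meanFieldSpace n k,
      objective A τ' α' Q' ≤ objective A τ α Q

/-- `z` is a variational estimator of the labels: `z i` maximizes `a ↦ τ i a`, for a maximizer
`(α, Q, τ)` of the variational objective. -/
def IsVariationalLabels {n k : ℕ} (A : Matrix (Fin n) (Fin n) ℝ) (z : Labels n k) : Prop :=
  ∃ (α : Fin k → ℝ) (Q : Matrix (Fin k) (Fin k) ℝ) (τ : Fin n → Fin k → ℝ),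
    IsVariational A α Q τ ∧ ∀ i a, τ i a ≤ τ i (z i)

/-- The ordered pairs `(i, j)` with `i ≠ j`, `z i = a` and `z j = b`. -/
def block {n k : ℕ} (z : Labels n k) (a b : Fin k) : Finset (Fin n × Fin n) :=
  {p | z p.1 = a ∧ z p.2 = b ∧ p.1 ≠ p.2}

/-- The empirical mean of the adjacency matrix over the blocks of `z`. -/
def empiricalQ {n k : ℕ} (A : Matrix (Fin n) (Fin n) ℝ) (z : Labels n k) :
    Matrix (Fin k) (Fin k) ℝ := fun a b =>
  (∑ p ∈ block z a b, A p.1 p.2) / ((block z a b).card : ℝ)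

/-- The matrix of connection probabilities between nodes, `Q (z i) (z j)` off the diagonal and
`0` on the diagonal. -/
def theta {n k : ℕ} (z : Labels n k) (Q : Matrix (Fin k) (Fin k) ℝ) :
    Matrix (Fin n) (Fin n) ℝ := fun i j =>
  if i = j then 0 else Q (z i) (z j)

/-- The estimator of the matrix of connection probabilities obtained from the labels `z`. -/
def thetaHat {n k : ℕ} (A : Matrix (Fin n) (Fin n) ℝ) (z : Labels n k) :
    Matrix (Fin n) (Fin n) ℝ :=
  theta z (empiricalQ A z)

/-- The squared Frobenius norm. -/
def frobeniusSq {n : ℕ} (M : Matrix (Fin n) (Fin n) ℝ) : ℝ :=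
  ∑ i, ∑ j, M i j ^ 2

/-- Equality of label functions up to a permutation of the labels. -/
def LabelEquiv {n k : ℕ} (z z' : Labels n k) : Prop :=
  ∃ σ : Equiv.Perm (Fin k), ∀ i, z i = σ (z' i)

/-! ### The events of the theorem -/

/-- Both label estimators exist, and any two choices of them agree up to a permutation of the
labels. -/
def agreementEvent (n k : ℕ) : Set (Labels n k × Edges n) :=
  {ω | (∃ z : Labels n k, IsVariationalLabels (adjacency ω.2) z) ∧
    (∃ z : Labels n k, IsMLELabels (adjacency ω.2) z) ∧
    ∀ zVar zMle : Labels n k, IsVariationalLabels (adjacency ω.2) zVar →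
      IsMLELabels (adjacency ω.2) zMle → LabelEquiv zVar zMle}

/-- The variational estimator exists, and for any choice of it the squared Frobenius error of
the estimator of the matrix of connection probabilities is at most `r`; here `Q` is the true
matrix and `ω.1` the true label function. -/
def errorEvent (n : ℕ) {k : ℕ} (Q : Matrix (Fin k) (Fin k) ℝ) (r : ℝ) :
    Set (Labels n k × Edges n) :=
  {ω | (∃ z : Labels n k, IsVariationalLabels (adjacency ω.2) z) ∧
    ∀ z : Labels n k, IsVariationalLabels (adjacency ω.2) z →
      frobeniusSq (theta ω.1 Q - thetaHat (adjacency ω.2) z) ≤ r}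

end

end SBM

namespace SBM

/-! ### Sums over functions weighted by a product of probability vectors -/

section ProductWeights

variable {ι β : Type*} [Fintype ι] [DecidableEq ι] [Fintype β]

/-! The argument reduces everything to a deterministic statement, `HasLikelihoodGap`: with the true
labels `z₀`, every pair `(z, Q)` has log-likelihood below the profile log-likelihood of `z₀` by at
least `κ` times the number of misclassified nodes, up to a permutation that may depend on the pair.
Here `κ` is of order `ρ n * n`, hence much larger than `log n`.

The gap is a union bound (`edgesLaw_not_hasLikelihoodGap_le`). A violation can be moved to the
empirical matrix of `z`, which lies in a grid of polynomial size. For each point of the grid,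
Markov's inequality for the square root of the likelihood ratio gives a Bhattacharyya coefficient,
which decays like the exponential of a squared distance between square roots of connection
probabilities. Since the rows of `Q₀` are distinct, `exists_perm_hammingDist_le` bounds this
distance below by `ρ n * n` times the Hamming distance, up to a constant factor, so the sum over
labels and grid tends to zero.

With the gap, any maximum likelihood labels are a permutation of `z₀`. For the variational
estimator, the objective is an entropy-type term plus the mean of the log-likelihood under a product
law (`objective_eq`). Since the permutation in the gap depends on `z`, the mean is taken of pairwise
disagreements, which do not see permutations. A mean-field law at least as good as the point mass at
`z₀` has few expected disagreements, which produces one global permutation; the entropy and the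
label proportions then gain at most about `log n` per expected error, less than `κ` costs. The
expected number of errors is therefore below `1/2`, and every node puts mass above `1/2` on the
right label (`exists_perm_forall_half_lt`). The same concentration keeps good parameters in a
compact set, whence existence (`HasLikelihoodGap.exists_isVariational`).

Finally, once the labels are exact, the estimator of the connection probabilities is the block
average with the true labels. Its expected squared error is of order `k ^ 2 * ρ n`, so Markov's
inequality gives the error bound with constant `1`. -/

theorem sum_prod_apply (w : ι → β → ℝ) :
    ∑ z : ι → β, ∏ l, w l (z l) = ∏ l, ∑ b, w l b := by
  rw [Finset.prod_univ_sum, Fintype.piFinset_univ]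

theorem sum_prod_apply_eq_one {w : ι → β → ℝ} (hw : ∀ i, ∑ b, w i b = 1) :
    ∑ z : ι → β, ∏ l, w l (z l) = 1 := by
  rw [sum_prod_apply, Finset.prod_eq_one fun i _ => hw i]

theorem sum_prod_mul_apply {w : ι → β → ℝ} (hw : ∀ i, ∑ b, w i b = 1) (i : ι) (f : β → ℝ) :
    ∑ z : ι → β, (∏ l, w l (z l)) * f (z i) = ∑ b, w i b * f b := by
  have h : ∀ z : ι → β, (∏ l, w l (z l)) * f (z i)
      = ∏ l, (w l (z l) * if l = i then f (z l) else 1) := fun z => by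
    rw [Finset.prod_mul_distrib]; simp
  simp_rw [h]
  rw [sum_prod_apply (fun l b => w l b * if l = i then f b else 1),
    Fintype.prod_eq_single i]
  · simp
  · intro l hl
    simp [hl, hw]

theorem sum_prod_mul_apply_mul_apply {w : ι → β → ℝ} (hw : ∀ i, ∑ b, w i b = 1) {i j : ι}
    (hij : i ≠ j) (f g : β → ℝ) :
    ∑ z : ι → β, (∏ l, w l (z l)) * (f (z i) * g (z j))
      = (∑ b, w i b * f b) * ∑ b, w j b * g b := by
  have h : ∀ z : ι → β, (∏ l, w l (z l)) * (f (z i) * g (z j))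
      = ∏ l, (w l (z l) * ((if l = i then f (z l) else 1) * if l = j then g (z l) else 1)) :=
    fun z => by
      rw [Finset.prod_mul_distrib, Finset.prod_mul_distrib]; simp
  simp_rw [h]
  rw [sum_prod_apply
      (fun l b => w l b * ((if l = i then f b else 1) * if l = j then g b else 1)),
    Fintype.prod_eq_mul i j hij]
  · simp [hij, hij.symm]
  · intro l hl
    simp [hl.1, hl.2, hw]

theorem sum_prod_mul_pair {w : ι → β → ℝ} (hw : ∀ i, ∑ b, w i b = 1) {i j : ι}
    (hij : i ≠ j) [DecidableEq β] :
    ∑ z : ι → β, (∏ l, w l (z l)) * (if z i = z j then 1 else 0) = ∑ b, w i b * w j b := by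
  have h : ∀ z : ι → β, (∏ l, w l (z l)) * (if z i = z j then (1 : ℝ) else 0)
      = ∑ b, (∏ l, w l (z l)) * ((if z i = b then 1 else 0) * if z j = b then 1 else 0) := by
    intro z
    rw [← Finset.mul_sum]
    simp [eq_comm]
  simp_rw [h]
  rw [Finset.sum_comm]
  refine Finset.sum_congr rfl fun b _ => ?_
  rw [sum_prod_mul_apply_mul_apply hw hij (fun c => if c = b then 1 else 0)
    (fun c => if c = b then 1 else 0)]
  simp

end ProductWeights

/-! ### The variational objective -/

theorem sum_productProb {n k : ℕ} {τ : Fin n → Fin k → ℝ} (hτ : τ ∈ meanFieldSpace n k) :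
    ∑ z, productProb τ z = 1 :=
  sum_prod_apply_eq_one fun i => (hτ i).2

theorem productProb_nonneg {n k : ℕ} {τ : Fin n → Fin k → ℝ} (hτ : τ ∈ meanFieldSpace n k)
    (z : Labels n k) : 0 ≤ productProb τ z :=
  Finset.prod_nonneg fun i _ => (hτ i).1 _

theorem completeLik_pos {n k : ℕ} (A : Matrix (Fin n) (Fin n) ℝ) (z : Labels n k)
    {α : Fin k → ℝ} (hα : ∀ a, 0 < α a) (Q : Matrix (Fin k) (Fin k) ℝ) :
    0 < completeLik A z α Q :=
  mul_pos (Finset.prod_pos fun _ _ => hα _) (Real.exp_pos _)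

/-- The evidence `lik` cancels against the normalization of the posterior, which leaves the usual
evidence lower bound. -/
theorem objective_eq_sum {n k : ℕ} (A : Matrix (Fin n) (Fin n) ℝ) {τ : Fin n → Fin k → ℝ}
    {α : Fin k → ℝ} (Q : Matrix (Fin k) (Fin k) ℝ) (hα : α ∈ proportionSpace k)
    (hτ : τ ∈ meanFieldSpace n k) :
    objective A τ α Q = ∑ z, productProb τ z *
      (∑ i, Real.log (α (z i)) + logLik A z Q - Real.log (productProb τ z)) := by
  have hne : Nonempty (Labels n k) := by
    by_contra h
    rw [not_nonempty_iff] at h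
    have := sum_productProb hτ
    simp at this
  have hlik : 0 < lik A α Q :=
    Finset.sum_pos (fun z _ => completeLik_pos A z hα.1 Q) Finset.univ_nonempty
  have h : Real.log (lik A α Q) = ∑ z, productProb τ z * Real.log (lik A α Q) := by
    rw [← Finset.sum_mul, sum_productProb hτ, one_mul]
  rw [objective, KL, h, ← Finset.sum_sub_distrib]
  refine Finset.sum_congr rfl fun z _ => ?_
  -- A mean-field law may vanish at `z`; the logarithm of the quotient only splits where it does
  -- not.
  rcases eq_or_ne (productProb τ z) 0 with h0 | h0
  · simp [h0]
  have hc := completeLik_pos A z hα.1 Q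
  rw [posterior, Real.log_div h0 (div_pos hc hlik).ne', Real.log_div hc.ne' hlik.ne',
    completeLik, Real.log_mul (Finset.prod_pos fun _ _ => hα.1 _).ne' (Real.exp_pos _).ne',
    Real.log_exp, Real.log_prod fun i _ => (hα.1 (z i)).ne']
  ring

theorem objective_eq {n k : ℕ} (A : Matrix (Fin n) (Fin n) ℝ) {τ : Fin n → Fin k → ℝ}
    {α : Fin k → ℝ} (Q : Matrix (Fin k) (Fin k) ℝ) (hα : α ∈ proportionSpace k)
    (hτ : τ ∈ meanFieldSpace n k) :
    objective A τ α Q = ∑ i, ∑ a, τ i a * (Real.log (α a) - Real.log (τ i a))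
      + ∑ z, productProb τ z * logLik A z Q := by
  have h : ∀ z : Labels n k, productProb τ z *
      (∑ i, Real.log (α (z i)) + logLik A z Q - Real.log (productProb τ z))
      = ∑ i, productProb τ z * (Real.log (α (z i)) - Real.log (τ i (z i)))
        + productProb τ z * logLik A z Q := by
    intro z
    rcases eq_or_ne (productProb τ z) 0 with h0 | h0
    · simp [h0]
    have h1 : ∀ i, τ i (z i) ≠ 0 := fun i hi =>
      h0 (Finset.prod_eq_zero (Finset.mem_univ i) hi)
    rw [← Finset.mul_sum, Finset.sum_sub_distrib]
    conv_lhs => rw [productProb, Real.log_prod fun i _ => h1 i]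
    rw [productProb]
    ring
  rw [objective_eq_sum A Q hα hτ]
  simp_rw [h]
  rw [Finset.sum_add_distrib, Finset.sum_comm]
  congr 1
  refine Finset.sum_congr rfl fun i _ => ?_
  exact sum_prod_mul_apply (fun i => (hτ i).2) i fun a => Real.log (α a) - Real.log (τ i a)

/-! ### Recovering a permutation from pairwise agreement -/

section Simplex

variable {k : ℕ} {p q : Fin k → ℝ}

theorem le_one_of_mem_stdSimplex (hp : p ∈ stdSimplex ℝ (Fin k)) (a : Fin k) : p a ≤ 1 := by
  rw [← hp.2]
  exact Finset.single_le_sum (fun b _ => hp.1 b) (Finset.mem_univ a)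

theorem add_le_one_of_mem_stdSimplex (hp : p ∈ stdSimplex ℝ (Fin k)) {a b : Fin k}
    (hab : a ≠ b) : p a + p b ≤ 1 := by
  rw [← hp.2, ← Finset.sum_pair hab]
  exact Finset.sum_le_sum_of_subset_of_nonneg (Finset.subset_univ _) fun c _ _ => hp.1 c

theorem sum_mul_nonneg_of_mem_stdSimplex (hp : p ∈ stdSimplex ℝ (Fin k))
    (hq : q ∈ stdSimplex ℝ (Fin k)) : 0 ≤ ∑ a, p a * q a :=
  Finset.sum_nonneg fun a _ => mul_nonneg (hp.1 a) (hq.1 a)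

theorem sum_mul_le_of_forall_le {m : ℝ} (hq : q ∈ stdSimplex ℝ (Fin k))
    (hm : ∀ a, p a ≤ m) : ∑ a, p a * q a ≤ m := by
  calc ∑ a, p a * q a ≤ ∑ a, m * q a :=
        Finset.sum_le_sum fun a _ => mul_le_mul_of_nonneg_right (hm a) (hq.1 a)
    _ = m := by rw [← Finset.mul_sum, hq.2, mul_one]

/-- Away from `c` each `q a` is at most `1 - q c`, so the probability of agreement is controlled as
if there were only the two outcomes "`c`" and "not `c`". -/
theorem sum_mul_le_of_mem_stdSimplex (hp : p ∈ stdSimplex ℝ (Fin k))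
    (hq : q ∈ stdSimplex ℝ (Fin k)) (c : Fin k) :
    ∑ a, p a * q a ≤ p c * q c + (1 - p c) * (1 - q c) := by
  have h : ∑ a, p a = p c + ∑ a ∈ Finset.univ.erase c, p a :=
    (Finset.add_sum_erase _ _ (Finset.mem_univ c)).symm
  rw [hp.2] at h
  rw [← Finset.add_sum_erase _ _ (Finset.mem_univ c)]
  have : ∑ a ∈ Finset.univ.erase c, p a * q a ≤ ∑ a ∈ Finset.univ.erase c, p a * (1 - q c) := by
    refine Finset.sum_le_sum fun a ha => mul_le_mul_of_nonneg_left ?_ (hp.1 a)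
    linarith [add_le_one_of_mem_stdSimplex hq (Finset.ne_of_mem_erase ha)]
  rw [← Finset.sum_mul] at this
  rw [show 1 - p c = ∑ a ∈ Finset.univ.erase c, p a by linarith]
  linarith

theorem mul_le_sum_mul_of_mem_stdSimplex (hp : p ∈ stdSimplex ℝ (Fin k))
    (hq : q ∈ stdSimplex ℝ (Fin k)) (c : Fin k) : p c * q c ≤ ∑ a, p a * q a :=
  Finset.single_le_sum (f := fun a => p a * q a) (fun a _ => mul_nonneg (hp.1 a) (hq.1 a))
    (Finset.mem_univ c)

end Simplex

/-- The nodes with label `a`. -/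
def community {n k : ℕ} (z : Labels n k) (a : Fin k) : Finset (Fin n) := {i | z i = a}

@[simp] theorem mem_community {n k : ℕ} {z : Labels n k} {a : Fin k} {i : Fin n} :
    i ∈ community z a ↔ z i = a := by simp [community]

/-- Every community contains at least a proportion `δ` of the nodes. -/
def IsBalanced {n k : ℕ} (δ : ℝ) (z : Labels n k) : Prop :=
  ∀ a, δ * n ≤ (community z a).card

theorem sum_community {n k : ℕ} (z : Labels n k) (f : Fin n → ℝ) :
    ∑ a, ∑ i ∈ community z a, f i = ∑ i, f i := by
  simp only [community]
  exact Finset.sum_fiberwise _ _ _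

/-- The probability, under the product distribution `τ`, that the event "`i` and `j` have the same
label" differs from what it is for the label function `z₀`. -/
noncomputable def disagreement {n k : ℕ} (z₀ : Labels n k) (τ : Fin n → Fin k → ℝ)
    (i j : Fin n) : ℝ :=
  if i = j then 0
  else if z₀ i = z₀ j then 1 - ∑ a, τ i a * τ j a else ∑ a, τ i a * τ j a

section Disagreement

variable {n k : ℕ} {z₀ : Labels n k} {τ : Fin n → Fin k → ℝ}

theorem disagreement_nonneg (hτ : τ ∈ meanFieldSpace n k) (i j : Fin n) :
    0 ≤ disagreement z₀ τ i j := by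
  unfold disagreement
  split_ifs
  · exact le_rfl
  · linarith [sum_mul_le_of_forall_le (hτ j) (le_one_of_mem_stdSimplex (hτ i))]
  · exact sum_mul_nonneg_of_mem_stdSimplex (hτ i) (hτ j)

/-- The disagreement of a deterministic label function. -/
noncomputable def labelDisagreement (z₀ z : Labels n k) (i j : Fin n) : ℝ :=
  if i = j then 0
  else if z₀ i = z₀ j then 1 - (if z i = z j then 1 else 0) else if z i = z j then 1 else 0

theorem sum_productProb_mul_labelDisagreement (hτ : τ ∈ meanFieldSpace n k) (i j : Fin n) :
    ∑ z, productProb τ z * labelDisagreement z₀ z i j = disagreement z₀ τ i j := by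
  unfold labelDisagreement disagreement
  rcases eq_or_ne i j with h | h
  · simp [h]
  have hp := sum_prod_mul_pair (fun i => (hτ i).2) h
  by_cases h' : z₀ i = z₀ j
  · simp only [h, h', if_false, if_true, mul_sub, mul_one, Finset.sum_sub_distrib,
      sum_productProb hτ]
    rw [← hp]; rfl
  · simp only [h, h', if_false]
    rw [← hp]; rfl

theorem labelDisagreement_le (z₀ z : Labels n k) (σ : Equiv.Perm (Fin k)) (i j : Fin n) :
    labelDisagreement z₀ z i j ≤
      (if z i ≠ σ (z₀ i) then 1 else 0) + if z j ≠ σ (z₀ j) then 1 else 0 := by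
  unfold labelDisagreement
  have := σ.injective.eq_iff (a := z₀ i) (b := z₀ j)
  split_ifs <;> norm_num
  all_goals simp_all

/-- The left side does not involve `σ`. This is what allows gaps whose permutation varies with `z`
to be averaged over `z`. -/
theorem sum_labelDisagreement_le (z₀ z : Labels n k) (σ : Equiv.Perm (Fin k)) :
    ∑ i, ∑ j, labelDisagreement z₀ z i j ≤ 2 * n * hammingDist z (σ ∘ z₀) := by
  have h : (hammingDist z (σ ∘ z₀) : ℝ) = ∑ i, if z i ≠ σ (z₀ i) then (1 : ℝ) else 0 := by
    rw [Finset.sum_boole]; rfl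
  calc ∑ i, ∑ j, labelDisagreement z₀ z i j
      ≤ ∑ i, ∑ j, ((if z i ≠ σ (z₀ i) then (1 : ℝ) else 0)
          + if z j ≠ σ (z₀ j) then 1 else 0) :=
        Finset.sum_le_sum fun i _ => Finset.sum_le_sum fun j _ => labelDisagreement_le z₀ z σ i j
    _ = 2 * n * hammingDist z (σ ∘ z₀) := by
        rw [h]
        simp only [Finset.sum_add_distrib, Finset.sum_const, Finset.card_univ, Fintype.card_fin,
          nsmul_eq_mul, ← Finset.mul_sum]
        ring

/-- In each community there is a node whose row of disagreements is at most average. -/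
theorem exists_row_le (hτ : τ ∈ meanFieldSpace n k) {δ ε : ℝ} (hδ : 0 < δ) (hn : 0 < n)
    (hbal : IsBalanced δ z₀)
    (hT : ∑ i, ∑ j, disagreement z₀ τ i j ≤ δ * ε * n ^ 2) (a : Fin k) :
    ∃ i, z₀ i = a ∧ ∑ j, disagreement z₀ τ i j ≤ ε * n := by
  have hn' : (0 : ℝ) < n := by exact_mod_cast hn
  by_contra! hcon
  have hcard : (0 : ℝ) < (community z₀ a).card := (mul_pos hδ hn').trans_le (hbal a)
  have hne : (community z₀ a).Nonempty := Finset.card_pos.1 (by exact_mod_cast hcard)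
  have h0 : 0 ≤ ∑ i, ∑ j, disagreement z₀ τ i j :=
    Finset.sum_nonneg fun i _ => Finset.sum_nonneg fun j _ => disagreement_nonneg hτ i j
  have hε : 0 ≤ ε := by
    by_contra! h
    have := mul_neg_of_pos_of_neg (mul_pos hδ (pow_pos hn' 2)) h
    linarith [this, hT, mul_right_comm δ ε ((n : ℝ) ^ 2)]
  have h1 : ∑ i ∈ community z₀ a, ε * n < ∑ i ∈ community z₀ a, ∑ j, disagreement z₀ τ i j :=
    Finset.sum_lt_sum_of_nonempty hne fun i hi => hcon i (mem_community.1 hi)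
  have h2 : ∑ i ∈ community z₀ a, ∑ j, disagreement z₀ τ i j
      ≤ ∑ i, ∑ j, disagreement z₀ τ i j :=
    Finset.sum_le_sum_of_subset_of_nonneg (Finset.subset_univ _) fun i _ _ =>
      Finset.sum_nonneg fun j _ => disagreement_nonneg hτ i j
  rw [Finset.sum_const, nsmul_eq_mul] at h1
  have h3 := mul_le_mul_of_nonneg_right (hbal a) (mul_nonneg hε hn'.le)
  nlinarith

/-- Each community has a reference node that disagrees little with the other nodes. Its dominant
label names the community, and a small row of disagreements forces the rest of the community to
follow it. -/
theorem exists_perm_of_disagreement_le (hτ : τ ∈ meanFieldSpace n k) {δ : ℝ} (hδ : 0 < δ)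
    (hn : 16 ≤ δ * n) (hbal : IsBalanced δ z₀)
    (hT : ∑ i, ∑ j, disagreement z₀ τ i j ≤ δ ^ 2 / 16 * n ^ 2) :
    ∃ σ : Equiv.Perm (Fin k), ∀ a,
      ∑ i ∈ community z₀ a, (1 - τ i (σ a)) ≤ (community z₀ a).card / 4 := by
  have hn0 : 0 < n := by
    rcases Nat.eq_zero_or_pos n with h | h
    · rw [h] at hn; norm_num at hn
    · exact h
  have hrow := exists_row_le hτ hδ hn0 hbal (ε := δ / 16) (by linarith)
  choose r hr hrow using hrow
  have hpart : ∀ a (s : Finset (Fin n)), ∑ j ∈ s, disagreement z₀ τ (r a) j ≤ δ / 16 * n :=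
    fun a s => (Finset.sum_le_sum_of_subset_of_nonneg (Finset.subset_univ s)
      fun j _ _ => disagreement_nonneg hτ _ j).trans (hrow a)
  have hcard : ∀ a, (((community z₀ a).erase (r a)).card : ℝ) = (community z₀ a).card - 1 := by
    intro a
    rw [Finset.card_erase_of_mem (mem_community.2 (hr a)), Nat.cast_sub, Nat.cast_one]
    exact Finset.card_pos.2 ⟨r a, mem_community.2 (hr a)⟩
  have hsame : ∀ a, ∀ j ∈ (community z₀ a).erase (r a),
      disagreement z₀ τ (r a) j = 1 - ∑ b, τ (r a) b * τ j b := by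
    intro a j hj
    rw [Finset.mem_erase, mem_community] at hj
    rw [disagreement, if_neg (Ne.symm hj.1), if_pos (by rw [hr, hj.2])]
  -- Otherwise the reference node would disagree with probability at least `1/4` with every other
  -- member of its community, too much for its row.
  have hmax : ∀ a, ∃ c, 3 / 4 ≤ τ (r a) c := by
    intro a
    by_contra! h
    have h1 : ∑ j ∈ (community z₀ a).erase (r a), (1 / 4 : ℝ)
        ≤ ∑ j ∈ (community z₀ a).erase (r a), disagreement z₀ τ (r a) j := by
      refine Finset.sum_le_sum fun j hj => ?_
      rw [hsame a j hj]
      linarith [sum_mul_le_of_forall_le (hτ j) fun c => (h c).le]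
    rw [Finset.sum_const, nsmul_eq_mul, hcard] at h1
    linarith [hpart a ((community z₀ a).erase (r a)), hbal a]
  choose σ hσ using hmax
  have herr : ∀ a, ∑ i ∈ community z₀ a, (1 - τ i (σ a)) ≤ (community z₀ a).card / 4 := by
    intro a
    have h1 : ∑ j ∈ (community z₀ a).erase (r a), (1 / 2) * (1 - τ j (σ a))
        ≤ ∑ j ∈ (community z₀ a).erase (r a), disagreement z₀ τ (r a) j := by
      refine Finset.sum_le_sum fun j hj => ?_
      rw [hsame a j hj]
      have h2 := sum_mul_le_of_mem_stdSimplex (hτ (r a)) (hτ j) (σ a)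
      have h3 := le_one_of_mem_stdSimplex (hτ j) (σ a)
      have h4 := le_one_of_mem_stdSimplex (hτ (r a)) (σ a)
      have h5 := (hτ j).1 (σ a)
      nlinarith [hσ a]
    rw [← Finset.mul_sum] at h1
    rw [← Finset.add_sum_erase _ _ (mem_community.2 (hr a))]
    linarith [hpart a ((community z₀ a).erase (r a)), hbal a, hσ a]
  -- If two communities shared a label, the reference node of one would agree with most of the
  -- other, and each such agreement counts as a disagreement with `z₀`.
  have hinj : Function.Injective σ := by
    intro a b hab
    by_contra hne
    have h1 : ∑ j ∈ community z₀ b, (3 / 4) * (1 - (1 - τ j (σ b)))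
        ≤ ∑ j ∈ community z₀ b, disagreement z₀ τ (r a) j := by
      refine Finset.sum_le_sum fun j hj => ?_
      rw [mem_community] at hj
      have h2 : z₀ (r a) ≠ z₀ j := by rw [hr, hj]; exact hne
      rw [disagreement, if_neg (fun h => h2 (by rw [h])), if_neg h2, ← hab]
      have h3 := mul_le_sum_mul_of_mem_stdSimplex (hτ (r a)) (hτ j) (σ a)
      have h5 := (hτ j).1 (σ a)
      nlinarith [hσ a]
    rw [← Finset.mul_sum, Finset.sum_sub_distrib, Finset.sum_const, nsmul_eq_mul, mul_one] at h1
    linarith [hpart a (community z₀ b), hbal b, herr b]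
  exact ⟨Equiv.ofBijective σ (Finite.injective_iff_bijective.1 hinj), herr⟩

/-- Converse of `sum_labelDisagreement_le` in expectation: if node `i` errs while a member of its
community does not, the two disagree. By `hσ` the members carry total mass at least three quarters
of the community on the right label, so each error costs of order `δ * n` disagreements. -/
theorem mul_sum_le_sum_disagreement (hτ : τ ∈ meanFieldSpace n k) {δ : ℝ}
    (hn : 16 ≤ δ * n) (hbal : IsBalanced δ z₀) {σ : Fin k → Fin k}
    (hσ : ∀ a, ∑ i ∈ community z₀ a, (1 - τ i (σ a)) ≤ (community z₀ a).card / 4) :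
    δ * n / 2 * ∑ i, (1 - τ i (σ (z₀ i))) ≤ ∑ i, ∑ j, disagreement z₀ τ i j := by
  rw [Finset.mul_sum]
  refine Finset.sum_le_sum fun i _ => ?_
  set a := z₀ i with ha
  have hi : i ∈ community z₀ a := mem_community.2 ha.symm
  have he : 0 ≤ 1 - τ i (σ a) := by linarith [le_one_of_mem_stdSimplex (hτ i) (σ a)]
  calc δ * n / 2 * (1 - τ i (σ a))
      ≤ (1 - τ i (σ a)) * ∑ j ∈ (community z₀ a).erase i, (1 - (1 - τ j (σ a))) := by
        rw [mul_comm]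
        refine mul_le_mul_of_nonneg_left ?_ he
        rw [Finset.sum_sub_distrib, Finset.sum_const, nsmul_eq_mul, mul_one,
          Finset.card_erase_of_mem hi, Nat.cast_sub (Finset.card_pos.2 ⟨i, hi⟩), Nat.cast_one]
        have h1 := hσ a
        rw [← Finset.add_sum_erase _ _ hi] at h1
        linarith [hbal a]
    _ ≤ ∑ j ∈ (community z₀ a).erase i, disagreement z₀ τ i j := by
        rw [Finset.mul_sum]
        refine Finset.sum_le_sum fun j hj => ?_
        rw [Finset.mem_erase, mem_community] at hj
        rw [disagreement, if_neg (Ne.symm hj.1), if_pos (by rw [hj.2])]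
        have h2 := sum_mul_le_of_mem_stdSimplex (hτ i) (hτ j) (σ a)
        have h3 := le_one_of_mem_stdSimplex (hτ j) (σ a)
        have h5 := (hτ i).1 (σ a)
        nlinarith
    _ ≤ ∑ j, disagreement z₀ τ i j :=
        Finset.sum_le_sum_of_subset_of_nonneg (Finset.subset_univ _)
          fun j _ _ => disagreement_nonneg hτ i j

end Disagreement

/-! ### Concentration of the variational estimator -/

theorem mul_log_sub_log_le {x y : ℝ} (hx : 0 ≤ x) (hy : 0 < y) :
    x * (Real.log y - Real.log x) ≤ y - x := by
  rcases hx.eq_or_lt with rfl | hx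
  · simpa using hy.le
  rw [← Real.log_div hy.ne' hx.ne']
  have h := mul_le_mul_of_nonneg_left (Real.log_le_sub_one_of_pos (div_pos hy hx)) hx.le
  rwa [mul_sub, mul_one, mul_div_cancel₀ _ hx.ne'] at h

/-- A linear upper bound for the entropy function, with free slope `B`. The slope will be `2 * log
n`, which leaves an additive error of only `1 / n ^ 2`. -/
theorem negMulLog_le_mul_add_exp {x : ℝ} (hx : 0 ≤ x) (B : ℝ) :
    Real.negMulLog x ≤ B * x + Real.exp (-B) := by
  have h := mul_log_sub_log_le hx (Real.exp_pos (-B))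
  rw [Real.log_exp] at h
  rw [Real.negMulLog]
  nlinarith

theorem negMulLog_le_one_sub {x : ℝ} (hx : 0 ≤ x) : Real.negMulLog x ≤ 1 - x := by
  have h := mul_log_sub_log_le hx one_pos
  rw [Real.log_one] at h
  rw [Real.negMulLog]
  linarith

theorem sum_negMulLog_le {k : ℕ} {p : Fin k → ℝ} (hp : p ∈ stdSimplex ℝ (Fin k)) (c : Fin k)
    (B : ℝ) :
    ∑ a, Real.negMulLog (p a) ≤ (1 - p c) + B * (1 - p c) + k * Real.exp (-B) := by
  have h : ∑ a, p a = p c + ∑ a ∈ Finset.univ.erase c, p a :=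
    (Finset.add_sum_erase _ _ (Finset.mem_univ c)).symm
  rw [hp.2] at h
  rw [← Finset.add_sum_erase _ _ (Finset.mem_univ c)]
  have h1 : ∑ a ∈ Finset.univ.erase c, Real.negMulLog (p a)
      ≤ ∑ a ∈ Finset.univ.erase c, (B * p a + Real.exp (-B)) :=
    Finset.sum_le_sum fun a _ => negMulLog_le_mul_add_exp (hp.1 a) B
  have h2 : ∑ a ∈ Finset.univ.erase c, Real.exp (-B) ≤ k * Real.exp (-B) := by
    rw [Finset.sum_const, nsmul_eq_mul]
    refine mul_le_mul_of_nonneg_right ?_ (Real.exp_pos _).le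
    have : (Finset.univ.erase c).card ≤ k := by
      simp
    exact_mod_cast this
  rw [Finset.sum_add_distrib, ← Finset.mul_sum] at h1
  have h3 := negMulLog_le_one_sub (hp.1 c)
  rw [show 1 - p c = ∑ a ∈ Finset.univ.erase c, p a by linarith] at h3 ⊢
  linarith

/-- The proportions of nodes in the communities of `z`. -/
noncomputable def empiricalProportions {n k : ℕ} (z : Labels n k) (a : Fin k) : ℝ :=
  (community z a).card / n

theorem sum_card_community {n k : ℕ} (z : Labels n k) :
    ∑ a, ((community z a).card : ℝ) = n := by
  have := sum_community z fun _ => 1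
  simpa using this

theorem le_empiricalProportions {n k : ℕ} {δ : ℝ} {z : Labels n k} (hn : 0 < n)
    (hbal : IsBalanced δ z) (a : Fin k) : δ ≤ empiricalProportions z a := by
  rw [empiricalProportions, le_div_iff₀ (by exact_mod_cast hn)]
  exact hbal a

theorem empiricalProportions_mem {n k : ℕ} {δ : ℝ} {z : Labels n k} (hδ : 0 < δ) (hn : 0 < n)
    (hbal : IsBalanced δ z) : empiricalProportions z ∈ proportionSpace k := by
  refine ⟨fun a => hδ.trans_le (le_empiricalProportions hn hbal a), ?_⟩
  simp only [empiricalProportions]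
  rw [← Finset.sum_div, sum_card_community, div_self (by exact_mod_cast hn.ne')]

theorem mem_stdSimplex_of_mem_proportionSpace {k : ℕ} {α : Fin k → ℝ}
    (hα : α ∈ proportionSpace k) : α ∈ stdSimplex ℝ (Fin k) :=
  ⟨fun a => (hα.1 a).le, hα.2⟩

/-- Linearizing the logarithm at `β` leaves errors proportional to `E` plus `N * (α - β)`. The
latter is not small, but it sums to zero over the communities because both vectors of proportions
sum to one. -/
theorem mul_log_sub_mul_log_le {s m N α β δ E : ℝ} (hδ : 0 < δ) (hα : 0 < α) (hα1 : α ≤ 1)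
    (hβ : δ ≤ β) (hβ1 : β ≤ 1) (hs : 0 ≤ s) (hm : m = N * β) (hE : |s - m| ≤ E) :
    s * Real.log α - m * Real.log β
      ≤ E / δ + E * Real.log (1 / δ) + N * (α - β) := by
  have hβ0 : 0 < β := hδ.trans_le hβ
  have hE0 : 0 ≤ E := (abs_nonneg _).trans hE
  have h1 : Real.log α - Real.log β ≤ (α - β) / β := by
    rw [← Real.log_div hα.ne' hβ0.ne']
    calc _ ≤ α / β - 1 := Real.log_le_sub_one_of_pos (div_pos hα hβ0)
      _ = (α - β) / β := by field_simp
  have h2 : (s - m) * Real.log β ≤ E * Real.log (1 / δ) := by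
    calc (s - m) * Real.log β ≤ |(s - m) * Real.log β| := le_abs_self _
      _ = |s - m| * |Real.log β| := abs_mul _ _
      _ ≤ E * Real.log (1 / δ) := by
        refine mul_le_mul hE ?_ (abs_nonneg _) hE0
        rw [abs_of_nonpos (Real.log_nonpos hβ0.le hβ1), one_div, Real.log_inv]
        linarith [Real.log_le_log hδ hβ]
  have h3 : s * ((α - β) / β) = (s - m) * ((α - β) / β) + N * (α - β) := by
    rw [hm]; field_simp; ring
  have h4 : (s - m) * ((α - β) / β) ≤ E * (1 / δ) := by
    calc (s - m) * ((α - β) / β) ≤ |(s - m) * ((α - β) / β)| := le_abs_self _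
      _ = |s - m| * |(α - β) / β| := abs_mul _ _
      _ ≤ E * (1 / δ) := by
        refine mul_le_mul hE ?_ (abs_nonneg _) hE0
        rw [abs_div, abs_of_pos hβ0]
        exact div_le_div₀ zero_le_one (abs_le.2 ⟨by linarith, by linarith⟩) hδ hβ
  have h5 := mul_le_mul_of_nonneg_left h1 hs
  rw [mul_one_div] at h4
  linarith

/-- The price of the label proportions, when the label of node `i` is `σ (z₀ i)` up to an
error probability `1 - τ i (σ (z₀ i))`. -/
theorem sum_mul_log_sub_sum_log_le {n k : ℕ} {z₀ : Labels n k} {τ : Fin n → Fin k → ℝ}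
    {α : Fin k → ℝ} (hτ : τ ∈ meanFieldSpace n k) (hα : α ∈ proportionSpace k) {δ : ℝ}
    (hδ : 0 < δ) (hn : 0 < n) (hbal : IsBalanced δ z₀) (σ : Equiv.Perm (Fin k)) :
    ∑ i, ∑ a, τ i a * Real.log (α a) - ∑ i, Real.log (empiricalProportions z₀ (z₀ i))
      ≤ k * (1 / δ + Real.log (1 / δ)) * ∑ i, (1 - τ i (σ (z₀ i))) := by
  set E := ∑ i, (1 - τ i (σ (z₀ i))) with hE
  have hn' : (0 : ℝ) < n := by exact_mod_cast hn
  have hβ := empiricalProportions_mem hδ hn hbal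
  have h1 : ∑ i, ∑ a, τ i a * Real.log (α a)
      = ∑ b, (∑ i, τ i (σ b)) * Real.log (α (σ b)) := by
    rw [Finset.sum_comm, ← Equiv.sum_comp σ]
    simp_rw [Finset.sum_mul]
  have h2 : ∑ i, Real.log (empiricalProportions z₀ (z₀ i))
      = ∑ b, ((community z₀ b).card : ℝ) * Real.log (empiricalProportions z₀ b) := by
    rw [← sum_community z₀]
    refine Finset.sum_congr rfl fun b _ => ?_
    rw [Finset.sum_congr rfl fun i hi => by rw [mem_community.1 hi], Finset.sum_const,
      nsmul_eq_mul]
  have h3 : ∀ b, |∑ i, τ i (σ b) - ((community z₀ b).card : ℝ)| ≤ E := by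
    intro b
    have : ((community z₀ b).card : ℝ) = ∑ i, if z₀ i = b then 1 else 0 := by
      rw [Finset.sum_boole]; rfl
    rw [this, ← Finset.sum_sub_distrib]
    refine (Finset.abs_sum_le_sum_abs _ _).trans (Finset.sum_le_sum fun i _ => ?_)
    split_ifs with h
    · rw [h, abs_sub_comm, abs_of_nonneg]
      linarith [le_one_of_mem_stdSimplex (hτ i) (σ b)]
    -- For a node outside community `b`, mass on `σ b` is mass on a wrong label.
    · rw [sub_zero, abs_of_nonneg ((hτ i).1 _)]
      linarith [add_le_one_of_mem_stdSimplex (hτ i) (a := σ b) (b := σ (z₀ i))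
        fun h' => h (σ.injective h').symm]
  rw [h1, h2, ← Finset.sum_sub_distrib]
  calc _ ≤ ∑ b, (E / δ + E * Real.log (1 / δ) + n * (α (σ b) - empiricalProportions z₀ b)) := by
        refine Finset.sum_le_sum fun b _ => ?_
        refine mul_log_sub_mul_log_le hδ (hα.1 _)
          (le_one_of_mem_stdSimplex (mem_stdSimplex_of_mem_proportionSpace hα) _)
          (le_empiricalProportions hn hbal b)
          (le_one_of_mem_stdSimplex (mem_stdSimplex_of_mem_proportionSpace hβ) _)
          (Finset.sum_nonneg fun i _ => (hτ i).1 _) ?_ (h3 b)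
        rw [empiricalProportions, mul_div_cancel₀ _ hn'.ne']
    _ = k * (1 / δ + Real.log (1 / δ)) * E := by
        rw [Finset.sum_add_distrib, ← Finset.mul_sum, Finset.sum_sub_distrib,
          Equiv.sum_comp σ α, hα.2, hβ.2, Finset.sum_const, Finset.card_univ, Fintype.card_fin,
          nsmul_eq_mul]
        ring

/-- For each `z` the Hamming distance in the gap is replaced by the number of pairwise disagreements
over `2 * n`; the mean of the latter under the product law is explicit. -/
theorem sum_productProb_mul_logLik_le {n k : ℕ} {A : Matrix (Fin n) (Fin n) ℝ}
    {z₀ : Labels n k} {τ : Fin n → Fin k → ℝ} {Q : Matrix (Fin k) (Fin k) ℝ} {M κ : ℝ}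
    (hτ : τ ∈ meanFieldSpace n k) (hn : 0 < n) (hκ : 0 ≤ κ)
    (hgap : ∀ z : Labels n k, ∃ σ : Equiv.Perm (Fin k),
      logLik A z Q ≤ M - κ * hammingDist z (σ ∘ z₀)) :
    ∑ z, productProb τ z * logLik A z Q
      ≤ M - κ / (2 * n) * ∑ i, ∑ j, disagreement z₀ τ i j := by
  have hn' : (0 : ℝ) < n := by exact_mod_cast hn
  have h1 : ∑ i, ∑ j, disagreement z₀ τ i j
      = ∑ z, productProb τ z * ∑ i, ∑ j, labelDisagreement z₀ z i j := by
    simp_rw [← sum_productProb_mul_labelDisagreement hτ, Finset.mul_sum]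
    rw [Finset.sum_comm]
    simp_rw [fun j => Finset.sum_comm (s := (Finset.univ : Finset (Fin n)))
      (t := (Finset.univ : Finset (Labels n k)))
      (f := fun i z => productProb τ z * labelDisagreement z₀ z i j)]
    rw [Finset.sum_comm]
    exact Finset.sum_congr rfl fun z _ => Finset.sum_comm
  have h2 : M = ∑ z, productProb τ z * M := by rw [← Finset.sum_mul, sum_productProb hτ, one_mul]
  rw [h1, h2, Finset.mul_sum, ← Finset.sum_sub_distrib]
  refine Finset.sum_le_sum fun z _ => ?_
  obtain ⟨σ, hσ⟩ := hgap z
  rw [mul_left_comm, ← mul_sub]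
  refine mul_le_mul_of_nonneg_left (hσ.trans ?_) (productProb_nonneg hτ z)
  have h3 := mul_le_mul_of_nonneg_left (sum_labelDisagreement_le z₀ z σ)
    (div_nonneg hκ (by positivity : (0 : ℝ) ≤ 2 * n))
  have h4 : κ / (2 * n) * (2 * n * (hammingDist z (σ ∘ z₀) : ℝ))
      = κ * hammingDist z (σ ∘ z₀) := by field_simp
  linarith

/-- If the complete-data likelihood drops by `κ` for each misclassified node, with `κ` large
compared to `log n`, then all mean-field distributions that do better than the point mass at `z₀`
concentrate, up to a permutation of the labels, around `z₀`. -/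
theorem exists_perm_forall_half_lt {n k : ℕ} {A : Matrix (Fin n) (Fin n) ℝ}
    {z₀ : Labels n k} {τ : Fin n → Fin k → ℝ} {α : Fin k → ℝ} {Q : Matrix (Fin k) (Fin k) ℝ}
    {M κ δ : ℝ} (hδ : 0 < δ) (hδ1 : δ ≤ 1) (hn : 16 ≤ δ * n) (hnk : 2 * k < n)
    (hbal : IsBalanced δ z₀)
    (hκ₁ : 32 * Real.log (1 / δ) / δ ^ 2 < κ)
    (hκ₂ : k * (1 / δ + Real.log (1 / δ)) + 2 + 2 * Real.log n ≤ κ * δ / 4)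
    (hα : α ∈ proportionSpace k) (hτ : τ ∈ meanFieldSpace n k)
    (hgap : ∀ z : Labels n k, ∃ σ : Equiv.Perm (Fin k),
      logLik A z Q ≤ M - κ * hammingDist z (σ ∘ z₀))
    (hobj : ∑ i, Real.log (empiricalProportions z₀ (z₀ i)) + M ≤ objective A τ α Q) :
    ∃ σ : Equiv.Perm (Fin k), ∀ i, 1 / 2 < τ i (σ (z₀ i)) := by
  have hn0 : 0 < n := by omega
  have hn' : (0 : ℝ) < n := by exact_mod_cast hn0
  have hlogδ : 0 ≤ Real.log (1 / δ) := Real.log_nonneg (by rw [le_div_iff₀ hδ]; linarith)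
  have hκ : 0 < κ := lt_of_le_of_lt (by positivity) hκ₁
  rw [objective_eq A Q hα hτ] at hobj
  have hL := sum_productProb_mul_logLik_le hτ hn0 hκ.le hgap
  set T := ∑ i, ∑ j, disagreement z₀ τ i j with hT
  -- Minus a sum of relative entropies. This crude bound suffices for the first localization of `τ`.
  have hS : ∑ i, ∑ a, τ i a * (Real.log (α a) - Real.log (τ i a)) ≤ 0 := by
    refine Finset.sum_nonpos fun i _ => ?_
    calc _ ≤ ∑ a, (α a - τ i a) :=
          Finset.sum_le_sum fun a _ => mul_log_sub_log_le ((hτ i).1 a) (hα.1 a)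
      _ = 0 := by rw [Finset.sum_sub_distrib, hα.2, (hτ i).2, sub_self]
  have hprop : -∑ i, Real.log (empiricalProportions z₀ (z₀ i)) ≤ n * Real.log (1 / δ) := by
    rw [← Finset.sum_neg_distrib]
    calc _ ≤ ∑ i : Fin n, Real.log (1 / δ) := by
          refine Finset.sum_le_sum fun i _ => ?_
          rw [one_div, Real.log_inv]
          linarith [Real.log_le_log hδ (le_empiricalProportions hn0 hbal (z₀ i))]
      _ = _ := by simp
  have hT1 : κ / (2 * n) * T ≤ n * Real.log (1 / δ) := by linarith
  have hT2 : T ≤ δ ^ 2 / 16 * n ^ 2 := by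
    rw [div_mul_eq_mul_div, div_le_iff₀ (by positivity)] at hT1
    rw [div_lt_iff₀ (by positivity)] at hκ₁
    have h1 : κ * T ≤ κ * (δ ^ 2 / 16 * n ^ 2) := by
      have := mul_le_mul_of_nonneg_right hκ₁.le (sq_nonneg (n : ℝ))
      nlinarith
    exact le_of_mul_le_mul_left h1 hκ
  obtain ⟨σ, hσ⟩ := exists_perm_of_disagreement_le hτ hδ hn hbal hT2
  refine ⟨σ, fun i => ?_⟩
  have hT3 := mul_sum_le_sum_disagreement hτ hn hbal hσ
  have he : ∀ i, 0 ≤ 1 - τ i (σ (z₀ i)) := fun i => by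
    linarith [le_one_of_mem_stdSimplex (hτ i) (σ (z₀ i))]
  have hprice := sum_mul_log_sub_sum_log_le hτ hα hδ hn0 hbal σ
  set E := ∑ i, (1 - τ i (σ (z₀ i))) with hE
  have hT4 : κ * δ / 4 * E ≤ κ / (2 * n) * T := by
    calc κ * δ / 4 * E = κ / (2 * n) * (δ * n / 2 * E) := by field_simp; ring
      _ ≤ _ := mul_le_mul_of_nonneg_left hT3 (by positivity)
  -- The second, sharper estimate: the entropy is almost proportional to the expected number of
  -- errors, with residue `k / n` from the slope `2 * log n`.
  have hent : ∑ i, ∑ a, Real.negMulLog (τ i a) ≤ E + 2 * Real.log n * E + k / n := by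
    calc _ ≤ ∑ i, ((1 - τ i (σ (z₀ i))) + 2 * Real.log n * (1 - τ i (σ (z₀ i)))
            + k * Real.exp (-(2 * Real.log n))) :=
          Finset.sum_le_sum fun i _ => sum_negMulLog_le (hτ i) (σ (z₀ i)) (2 * Real.log n)
      _ = _ := by
          rw [Finset.sum_add_distrib, Finset.sum_add_distrib, ← Finset.mul_sum, ← hE,
            Finset.sum_const, Finset.card_univ, Fintype.card_fin, nsmul_eq_mul, Real.exp_neg, two_mul,
            Real.exp_add, Real.exp_log hn']
          field_simp
  have hsplit : ∑ i, ∑ a, τ i a * (Real.log (α a) - Real.log (τ i a))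
      = ∑ i, ∑ a, τ i a * Real.log (α a) + ∑ i, ∑ a, Real.negMulLog (τ i a) := by
    simp_rw [← Finset.sum_add_distrib, Real.negMulLog]
    refine Finset.sum_congr rfl fun i _ => Finset.sum_congr rfl fun a _ => by ring
  have hE0 : 0 ≤ E := Finset.sum_nonneg fun i _ => he i
  have h6 := mul_le_mul_of_nonneg_right hκ₂ hE0
  -- The constant `2` in `hκ₂` absorbs one `E` from the entropy and leaves another, bounded by the
  -- residue.
  have h7 : E ≤ k / n := by linarith
  have h8 : (k : ℝ) / n < 1 / 2 := by
    rw [div_lt_div_iff₀ hn' two_pos]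
    have : (2 * k : ℝ) < n := by exact_mod_cast hnk
    linarith
  have h9 : 1 - τ i (σ (z₀ i)) ≤ E :=
    Finset.single_le_sum (f := fun i => 1 - τ i (σ (z₀ i))) (fun i _ => he i) (Finset.mem_univ i)
  linarith

/-! ### Existence of the estimators -/

section Adjacency

variable {n : ℕ} (x : Edges n)

theorem adjacency_pair (e : NodePair n) :
    adjacency x e.1.1 e.1.2 = if x e then 1 else 0 := by
  obtain ⟨⟨i, j⟩, h⟩ := e
  have h' : i < j := h
  simp [adjacency, h']

theorem adjacency_symm (i j : Fin n) : adjacency x i j = adjacency x j i := by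
  unfold adjacency
  rcases lt_trichotomy i j with h | h | h
  · simp [h, h.not_gt]
  · simp [h]
  · simp [h, h.not_gt]

theorem adjacency_eq_zero_or_one (i j : Fin n) : adjacency x i j = 0 ∨ adjacency x i j = 1 := by
  unfold adjacency
  split_ifs <;> simp

theorem adjacency_nonneg (i j : Fin n) : 0 ≤ adjacency x i j := by
  rcases adjacency_eq_zero_or_one x i j with h | h <;> simp [h]

theorem adjacency_le_one (i j : Fin n) : adjacency x i j ≤ 1 := by
  rcases adjacency_eq_zero_or_one x i j with h | h <;> simp [h]

variable {x} {k : ℕ} {Q : Matrix (Fin k) (Fin k) ℝ}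

theorem logLik_term_nonpos (hQ : Q ∈ connectionSpace k) (z : Labels n k) (i j : Fin n) :
    adjacency x i j * Real.log (Q (z i) (z j))
      + (1 - adjacency x i j) * Real.log (1 - Q (z i) (z j)) ≤ 0 := by
  have h := hQ.2 (z i) (z j)
  refine add_nonpos (mul_nonpos_of_nonneg_of_nonpos (adjacency_nonneg x i j)
    (Real.log_nonpos h.1.le h.2.le)) (mul_nonpos_of_nonneg_of_nonpos
    (sub_nonneg.2 (adjacency_le_one x i j)) (Real.log_nonpos ?_ ?_)) <;> linarith

theorem logLik_nonpos (hQ : Q ∈ connectionSpace k) (z : Labels n k) :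
    logLik (adjacency x) z Q ≤ 0 :=
  Finset.sum_nonpos fun _ _ => logLik_term_nonpos hQ z _ _

theorem logLik_le_term (hQ : Q ∈ connectionSpace k) (z : Labels n k) {i j : Fin n}
    (hij : i ≠ j) :
    logLik (adjacency x) z Q ≤ adjacency x i j * Real.log (Q (z i) (z j))
      + (1 - adjacency x i j) * Real.log (1 - Q (z i) (z j)) := by
  wlog h : i < j generalizing i j
  · rw [adjacency_symm, hQ.1.apply (z j) (z i)]
    exact this hij.symm (lt_of_le_of_ne (not_lt.1 h) hij.symm)
  have h1 := Finset.add_sum_erase Finset.univ (fun e : NodePair n =>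
    adjacency x e.1.1 e.1.2 * Real.log (Q (z e.1.1) (z e.1.2))
      + (1 - adjacency x e.1.1 e.1.2) * Real.log (1 - Q (z e.1.1) (z e.1.2)))
    (Finset.mem_univ ⟨(i, j), h⟩)
  rw [logLik, ← h1]
  have h2 := Finset.sum_nonpos fun (e : NodePair n)
    (_ : e ∈ Finset.univ.erase (⟨(i, j), h⟩ : NodePair n)) =>
      logLik_term_nonpos (x := x) hQ z e.1.1 e.1.2
  linarith

theorem exists_edge_of_empiricalQ_pos {z : Labels n k} {a b : Fin k}
    (h : 0 < empiricalQ (adjacency x) z a b) :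
    ∃ p ∈ block z a b, adjacency x p.1 p.2 = 1 := by
  by_contra! hcon
  have : ∑ p ∈ block z a b, adjacency x p.1 p.2 = 0 :=
    Finset.sum_eq_zero fun p hp =>
      (adjacency_eq_zero_or_one x p.1 p.2).resolve_right (hcon p hp)
  rw [empiricalQ, this, zero_div] at h
  exact lt_irrefl _ h

theorem exists_nonedge_of_empiricalQ_lt_one {z : Labels n k} {a b : Fin k}
    (h0 : 0 < empiricalQ (adjacency x) z a b) (h : empiricalQ (adjacency x) z a b < 1) :
    ∃ p ∈ block z a b, adjacency x p.1 p.2 = 0 := by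
  obtain ⟨q, hq, -⟩ := exists_edge_of_empiricalQ_pos h0
  by_contra! hcon
  have h1 : ∑ p ∈ block z a b, adjacency x p.1 p.2 = (block z a b).card := by
    rw [Finset.sum_congr rfl fun p hp =>
      (adjacency_eq_zero_or_one x p.1 p.2).resolve_left (hcon p hp)]
    simp
  have h2 : ((block z a b).card : ℝ) ≠ 0 := by
    exact_mod_cast (Finset.card_pos.2 ⟨q, hq⟩).ne'
  rw [empiricalQ, h1, div_self h2] at h
  exact lt_irrefl _ h

end Adjacency

section Existence

variable {n k : ℕ}

theorem objective_eq_sum_add_entropy (A : Matrix (Fin n) (Fin n) ℝ) {τ : Fin n → Fin k → ℝ}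
    {α : Fin k → ℝ} (Q : Matrix (Fin k) (Fin k) ℝ) (hα : α ∈ proportionSpace k)
    (hτ : τ ∈ meanFieldSpace n k) :
    objective A τ α Q = ∑ z, (productProb τ z * (∑ i, Real.log (α (z i)) + logLik A z Q)
      + Real.negMulLog (productProb τ z)) := by
  rw [objective_eq_sum A Q hα hτ]
  refine Finset.sum_congr rfl fun z _ => ?_
  rw [Real.negMulLog]
  ring

/-- The mean-field distribution that is a point mass at `z`. -/
noncomputable def pointMass (z : Labels n k) (i : Fin n) (a : Fin k) : ℝ :=
  if z i = a then 1 else 0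

theorem pointMass_mem (z : Labels n k) : pointMass z ∈ meanFieldSpace n k := by
  intro i
  refine ⟨fun a => ?_, ?_⟩
  · unfold pointMass; split_ifs <;> norm_num
  · simp [pointMass]

theorem productProb_pointMass (z z' : Labels n k) :
    productProb (pointMass z) z' = if z = z' then 1 else 0 := by
  unfold productProb pointMass
  split_ifs with h
  · simp [h]
  · obtain ⟨i, hi⟩ := Function.ne_iff.1 h
    exact Finset.prod_eq_zero (Finset.mem_univ i) (by simp [hi])

theorem objective_pointMass (A : Matrix (Fin n) (Fin n) ℝ) {α : Fin k → ℝ}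
    (Q : Matrix (Fin k) (Fin k) ℝ) (hα : α ∈ proportionSpace k) (z : Labels n k) :
    objective A (pointMass z) α Q = ∑ i, Real.log (α (z i)) + logLik A z Q := by
  rw [objective_eq_sum A Q hα (pointMass_mem z)]
  simp only [productProb_pointMass]
  rw [Finset.sum_eq_single z]
  · simp
  · intro b _ hb
    simp [hb.symm]
  · simp

/-- A compact part of the variational parameter space. -/
def parameterBox (n k : ℕ) (η : ℝ) :
    Set ((Fin n → Fin k → ℝ) × (Fin k → ℝ) × Matrix (Fin k) (Fin k) ℝ) :=
  meanFieldSpace n k ×ˢ ((stdSimplex ℝ (Fin k) ∩ {α | ∀ a, η ≤ α a}) ×ˢ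
    {Q : Matrix (Fin k) (Fin k) ℝ | Q.IsSymm ∧ ∀ a b, Q a b ∈ Set.Icc η (1 - η)})

theorem isCompact_parameterBox (η : ℝ) : IsCompact (parameterBox n k η) := by
  have h1 : meanFieldSpace n k = Set.pi Set.univ fun _ => stdSimplex ℝ (Fin k) := by
    ext τ; simp [meanFieldSpace]
  refine IsCompact.prod ?_ (IsCompact.prod ?_ ?_)
  · rw [h1]
    exact isCompact_univ_pi fun _ => isCompact_stdSimplex ℝ (Fin k)
  · refine (isCompact_stdSimplex ℝ (Fin k)).inter_right ?_
    rw [Set.ofPred_forall]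
    exact isClosed_iInter fun a => isClosed_le continuous_const (continuous_apply a)
  · have h2 : {Q : Matrix (Fin k) (Fin k) ℝ | Q.IsSymm ∧ ∀ a b, Q a b ∈ Set.Icc η (1 - η)}
        = {Q : Matrix (Fin k) (Fin k) ℝ | Q.transpose = Q}
          ∩ Set.pi Set.univ fun _ => Set.pi Set.univ fun _ => Set.Icc η (1 - η) := by
      ext Q
      exact ⟨fun h => ⟨h.1, fun a _ b _ => h.2 a b⟩,
        fun h => ⟨h.1, fun a b => h.2 a trivial b trivial⟩⟩
    rw [h2]
    refine IsCompact.inter_left ?_ ?_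
    · exact isCompact_univ_pi fun _ => isCompact_univ_pi fun _ => isCompact_Icc
    · exact isClosed_eq (Continuous.matrix_transpose continuous_id) continuous_id

theorem mem_parameterBox {η : ℝ} {τ : Fin n → Fin k → ℝ} {α : Fin k → ℝ}
    {Q : Matrix (Fin k) (Fin k) ℝ} (hα : α ∈ proportionSpace k) (hQ : Q ∈ connectionSpace k)
    (hτ : τ ∈ meanFieldSpace n k) (h1 : ∀ a, η ≤ α a)
    (h2 : ∀ a b, η ≤ Q a b ∧ η ≤ 1 - Q a b) : (τ, α, Q) ∈ parameterBox n k η := by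
  refine ⟨hτ, ⟨mem_stdSimplex_of_mem_proportionSpace hα, h1⟩, hQ.1, fun a b => ?_⟩
  exact ⟨(h2 a b).1, by linarith [(h2 a b).2]⟩

theorem of_mem_parameterBox {η : ℝ} (hη : 0 < η)
    {p : (Fin n → Fin k → ℝ) × (Fin k → ℝ) × Matrix (Fin k) (Fin k) ℝ}
    (hp : p ∈ parameterBox n k η) :
    p.1 ∈ meanFieldSpace n k ∧ p.2.1 ∈ proportionSpace k ∧ p.2.2 ∈ connectionSpace k := by
  obtain ⟨h1, ⟨h2, h3⟩, h4, h5⟩ := hp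
  refine ⟨h1, ⟨fun a => hη.trans_le (h3 a), h2.2⟩, h4, fun a b => ?_⟩
  have := h5 a b
  exact ⟨hη.trans_le this.1, by linarith [this.2]⟩

theorem continuousOn_objective (A : Matrix (Fin n) (Fin n) ℝ) {η : ℝ} (hη : 0 < η) :
    ContinuousOn (fun p : (Fin n → Fin k → ℝ) × (Fin k → ℝ) × Matrix (Fin k) (Fin k) ℝ =>
      objective A p.1 p.2.1 p.2.2) (parameterBox n k η) := by
  -- Written with `negMulLog`, the objective is visibly continuous also where `productProb`
  -- vanishes; the other logarithms stay away from zero on the box.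
  refine ContinuousOn.congr (f := fun p => ∑ z, (productProb p.1 z *
    (∑ i, Real.log (p.2.1 (z i)) + logLik A z p.2.2) + Real.negMulLog (productProb p.1 z))) ?_
    fun p hp => ?_
  · have hprob : ∀ z, ContinuousOn (fun p : (Fin n → Fin k → ℝ) × (Fin k → ℝ) ×
        Matrix (Fin k) (Fin k) ℝ => productProb p.1 z) (parameterBox n k η) := by
      intro z
      unfold productProb
      fun_prop
    have hQ : ∀ a b, Continuous (fun p : (Fin n → Fin k → ℝ) × (Fin k → ℝ) ×
        Matrix (Fin k) (Fin k) ℝ => p.2.2 a b) := fun a b =>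
      (continuous_apply b).comp ((continuous_apply a).comp (continuous_snd.comp continuous_snd))
    refine continuousOn_finsetSum _ fun z _ => ContinuousOn.add (ContinuousOn.mul (hprob z)
      (ContinuousOn.add ?_ ?_)) (Real.continuous_negMulLog.comp_continuousOn (hprob z))
    · refine continuousOn_finsetSum _ fun i _ => ContinuousOn.log (by fun_prop) fun p hp => ?_
      exact ((of_mem_parameterBox hη hp).2.1.1 _).ne'
    · refine continuousOn_finsetSum _ fun e _ => ContinuousOn.add
        (ContinuousOn.mul continuousOn_const (ContinuousOn.log (hQ _ _).continuousOn ?_))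
        (ContinuousOn.mul continuousOn_const (ContinuousOn.log
          (continuous_const.sub (hQ _ _)).continuousOn ?_)) <;> intro p hp
      · exact ((of_mem_parameterBox hη hp).2.2.2 _ _).1.ne'
      · exact (sub_pos.2 ((of_mem_parameterBox hη hp).2.2.2 _ _).2).ne'
  · obtain ⟨h1, h2, -⟩ := of_mem_parameterBox hη hp
    exact objective_eq_sum_add_entropy A _ h2 h1

/-- A mean-field distribution that concentrates on `z` bounds the complete-data log-likelihood
of `z` from below in terms of the objective. -/
theorem le_complete_logLik {x : Edges n} {τ : Fin n → Fin k → ℝ} {α : Fin k → ℝ}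
    {Q : Matrix (Fin k) (Fin k) ℝ} (hα : α ∈ proportionSpace k) (hτ : τ ∈ meanFieldSpace n k)
    (hQ : Q ∈ connectionSpace k) {z : Labels n k} (hz : ∀ i, 1 / 2 < τ i (z i)) :
    2 ^ n * (objective (adjacency x) τ α Q - Fintype.card (Labels n k))
      ≤ ∑ i, Real.log (α (z i)) + logLik (adjacency x) z Q := by
  have hneg : ∀ z : Labels n k, ∑ i, Real.log (α (z i)) + logLik (adjacency x) z Q ≤ 0 :=
    fun z => add_nonpos (Finset.sum_nonpos fun i _ => Real.log_nonpos (hα.1 _).le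
      (le_one_of_mem_stdSimplex (mem_stdSimplex_of_mem_proportionSpace hα) _)) (logLik_nonpos hQ z)
  have h1 : objective (adjacency x) τ α Q ≤ productProb τ z *
      (∑ i, Real.log (α (z i)) + logLik (adjacency x) z Q) + Fintype.card (Labels n k) := by
    rw [objective_eq_sum_add_entropy _ _ hα hτ, Finset.sum_add_distrib]
    refine add_le_add ?_ ?_
    · rw [← Finset.add_sum_erase _ _ (Finset.mem_univ z)]
      have := Finset.sum_nonpos fun z' (_ : z' ∈ Finset.univ.erase z) =>
        mul_nonpos_of_nonneg_of_nonpos (productProb_nonneg hτ z') (hneg z')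
      linarith
    · calc _ ≤ ∑ _z : Labels n k, (1 : ℝ) := by
            refine Finset.sum_le_sum fun z' _ => ?_
            have h0 := productProb_nonneg hτ z'
            linarith [negMulLog_le_one_sub h0]
        _ = _ := by simp
  have h2 : (1 / 2) ^ n ≤ productProb τ z := by
    calc _ = ∏ _i : Fin n, (1 / 2 : ℝ) := by simp
      _ ≤ _ := Finset.prod_le_prod (fun _ _ => by norm_num) fun i _ => (hz i).le
  have h3 : (1 : ℝ) ≤ 2 ^ n * productProb τ z := by
    calc (1 : ℝ) = 2 ^ n * (1 / 2) ^ n := by rw [← mul_pow]; norm_num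
      _ ≤ _ := mul_le_mul_of_nonneg_left h2 (by positivity)
  have h4 := mul_le_mul_of_nonneg_left h1 (by positivity : (0 : ℝ) ≤ 2 ^ n)
  -- The complete log-likelihood is nonpositive, so multiplying it by `2 ^ n * productProb τ z ≥ 1`
  -- can only decrease it.
  nlinarith [hneg z]

/-- An interior empirical matrix means that every label is used and every block contains both an
edge and a nonedge. Hence each `log (α a)`, `log (Q a b)` and `log (1 - Q a b)` occurs among
summands that are all nonpositive, and is bounded below by `B`. -/
theorem exp_le_of_le_complete_logLik {x : Edges n} {α : Fin k → ℝ}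
    {Q : Matrix (Fin k) (Fin k) ℝ} (hα : α ∈ proportionSpace k) (hQ : Q ∈ connectionSpace k)
    {z : Labels n k} (hemp : empiricalQ (adjacency x) z ∈ connectionSpace k) {B : ℝ}
    (hB : B ≤ ∑ i, Real.log (α (z i)) + logLik (adjacency x) z Q) :
    (∀ a, Real.exp B ≤ α a) ∧ ∀ a b, Real.exp B ≤ Q a b ∧ Real.exp B ≤ 1 - Q a b := by
  have hneg : ∀ i, Real.log (α (z i)) ≤ 0 := fun i => Real.log_nonpos (hα.1 _).le
      (le_one_of_mem_stdSimplex (mem_stdSimplex_of_mem_proportionSpace hα) _)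
  have hsum : ∑ i, Real.log (α (z i)) ≤ 0 := Finset.sum_nonpos fun i _ => hneg i
  refine ⟨fun a => ?_, fun a b => ⟨?_, ?_⟩⟩
  · rw [← Real.le_log_iff_exp_le (hα.1 a)]
    obtain ⟨p, hp, -⟩ := exists_edge_of_empiricalQ_pos (hemp.2 a a).1
    simp only [block, Finset.mem_filter, Finset.mem_univ, true_and] at hp
    have h1 := Finset.add_sum_erase Finset.univ (fun i => Real.log (α (z i)))
      (Finset.mem_univ p.1)
    have h2 := Finset.sum_nonpos fun i (_ : i ∈ Finset.univ.erase p.1) => hneg i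
    rw [← h1] at hB
    simp only [hp.1] at hB
    linarith [logLik_nonpos (x := x) hQ z]
  · rw [← Real.le_log_iff_exp_le (hQ.2 a b).1]
    obtain ⟨p, hp, hp1⟩ := exists_edge_of_empiricalQ_pos (hemp.2 a b).1
    simp only [block, Finset.mem_filter, Finset.mem_univ, true_and] at hp
    have := logLik_le_term (x := x) hQ z hp.2.2
    rw [hp1, hp.1, hp.2.1] at this
    linarith
  · rw [← Real.le_log_iff_exp_le (sub_pos.2 (hQ.2 a b).2)]
    obtain ⟨p, hp, hp1⟩ := exists_nonedge_of_empiricalQ_lt_one (hemp.2 a b).1 (hemp.2 a b).2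
    simp only [block, Finset.mem_filter, Finset.mem_univ, true_and] at hp
    have := logLik_le_term (x := x) hQ z hp.2.2
    rw [hp1, hp.1, hp.2.1] at this
    linarith

end Existence

/-! ### Blocks and relabelling -/

section Relabel

variable {n k : ℕ}

theorem block_perm_comp (z : Labels n k) (σ : Equiv.Perm (Fin k)) (a b : Fin k) :
    block (σ ∘ z) (σ a) (σ b) = block z a b := by
  simp [block]

theorem empiricalQ_perm_comp (A : Matrix (Fin n) (Fin n) ℝ) (z : Labels n k)
    (σ : Equiv.Perm (Fin k)) (a b : Fin k) :
    empiricalQ A (σ ∘ z) (σ a) (σ b) = empiricalQ A z a b := by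
  simp only [empiricalQ, block_perm_comp]

theorem thetaHat_perm_comp (A : Matrix (Fin n) (Fin n) ℝ) (z : Labels n k)
    (σ : Equiv.Perm (Fin k)) : thetaHat A (σ ∘ z) = thetaHat A z := by
  ext i j
  simp only [thetaHat, theta, Function.comp_apply, empiricalQ_perm_comp]

end Relabel

/-! ### Exact recovery from a likelihood gap -/

/-- For all parameters, the log-likelihood of `z` is smaller than the maximal log-likelihood of
`z₀` by `κ` times the number of misclassified nodes. -/
def HasLikelihoodGap {n k : ℕ} (A : Matrix (Fin n) (Fin n) ℝ) (z₀ : Labels n k) (κ : ℝ) : Prop :=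
  ∀ Q ∈ connectionSpace k, ∀ z : Labels n k, ∃ σ : Equiv.Perm (Fin k),
    logLik A z Q ≤ logLik A z₀ (empiricalQ A z₀) - κ * hammingDist z (σ ∘ z₀)

section Recovery

variable {n k : ℕ} {x : Edges n} {z₀ : Labels n k} {κ : ℝ}

theorem HasLikelihoodGap.isMLE (hgap : HasLikelihoodGap (adjacency x) z₀ κ) (hκ : 0 ≤ κ)
    (hemp : empiricalQ (adjacency x) z₀ ∈ connectionSpace k) :
    IsMLE (adjacency x) (empiricalQ (adjacency x) z₀) z₀ := by
  refine ⟨hemp, fun Q hQ z => ?_⟩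
  obtain ⟨σ, hσ⟩ := hgap Q hQ z
  have := mul_nonneg hκ (Nat.cast_nonneg (α := ℝ) (hammingDist z (σ ∘ z₀)))
  linarith

theorem HasLikelihoodGap.eq_perm_comp_of_isMLELabels
    (hgap : HasLikelihoodGap (adjacency x) z₀ κ) (hκ : 0 < κ)
    (hemp : empiricalQ (adjacency x) z₀ ∈ connectionSpace k) {z : Labels n k}
    (hz : IsMLELabels (adjacency x) z) : ∃ σ : Equiv.Perm (Fin k), z = σ ∘ z₀ := by
  obtain ⟨Q, hQ, hmax⟩ := hz
  obtain ⟨σ, hσ⟩ := hgap Q hQ z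
  refine ⟨σ, hammingDist_eq_zero.1 ?_⟩
  have h1 : κ * (hammingDist z (σ ∘ z₀) : ℝ) ≤ 0 := by linarith [hmax _ hemp z₀]
  have h2 : (hammingDist z (σ ∘ z₀) : ℝ) ≤ 0 := by
    by_contra! h
    linarith [mul_pos hκ h]
  exact_mod_cast le_antisymm h2 (Nat.cast_nonneg _)

variable {δ : ℝ}

theorem HasLikelihoodGap.exists_perm (hgap : HasLikelihoodGap (adjacency x) z₀ κ)
    (hδ : 0 < δ) (hδ1 : δ ≤ 1) (hn : 16 ≤ δ * n) (hnk : 2 * k < n) (hbal : IsBalanced δ z₀)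
    (hκ₁ : 32 * Real.log (1 / δ) / δ ^ 2 < κ)
    (hκ₂ : k * (1 / δ + Real.log (1 / δ)) + 2 + 2 * Real.log n ≤ κ * δ / 4)
    {τ : Fin n → Fin k → ℝ} {α : Fin k → ℝ} {Q : Matrix (Fin k) (Fin k) ℝ}
    (hα : α ∈ proportionSpace k) (hQ : Q ∈ connectionSpace k) (hτ : τ ∈ meanFieldSpace n k)
    (hobj : objective (adjacency x) (pointMass z₀) (empiricalProportions z₀)
      (empiricalQ (adjacency x) z₀) ≤ objective (adjacency x) τ α Q) :
    ∃ σ : Equiv.Perm (Fin k), ∀ i, 1 / 2 < τ i ((σ ∘ z₀) i) := by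
  rw [objective_pointMass _ _ (empiricalProportions_mem hδ (by omega) hbal)] at hobj
  exact exists_perm_forall_half_lt hδ hδ1 hn hnk hbal hκ₁ hκ₂ hα hτ (hgap Q hQ) hobj

/-- The spaces of `α` and `Q` are not closed, so compactness is recovered from the objective:
parameters at least as good as the point mass at `z₀` concentrate on a permutation of `z₀`, which
keeps their `α` and `Q` a fixed distance from the boundary. -/
theorem HasLikelihoodGap.exists_isVariational (hgap : HasLikelihoodGap (adjacency x) z₀ κ)
    (hδ : 0 < δ) (hδ1 : δ ≤ 1) (hn : 16 ≤ δ * n) (hnk : 2 * k < n) (hbal : IsBalanced δ z₀)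
    (hκ₁ : 32 * Real.log (1 / δ) / δ ^ 2 < κ)
    (hκ₂ : k * (1 / δ + Real.log (1 / δ)) + 2 + 2 * Real.log n ≤ κ * δ / 4)
    (hemp : empiricalQ (adjacency x) z₀ ∈ connectionSpace k) :
    ∃ α Q, ∃ τ : Fin n → Fin k → ℝ, IsVariational (adjacency x) α Q τ := by
  have hprop := empiricalProportions_mem hδ (by omega) hbal
  obtain ⟨V, hV⟩ : ∃ V, V = objective (adjacency x) (pointMass z₀) (empiricalProportions z₀)
    (empiricalQ (adjacency x) z₀) := ⟨_, rfl⟩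
  obtain ⟨η, hη⟩ : ∃ η, η = Real.exp (2 ^ n * (V - Fintype.card (Labels n k))) := ⟨_, rfl⟩
  have hη0 : 0 < η := hη ▸ Real.exp_pos _
  have hbox : ∀ α ∈ proportionSpace k, ∀ Q ∈ connectionSpace k, ∀ τ ∈ meanFieldSpace n k,
      V ≤ objective (adjacency x) τ α Q → (τ, α, Q) ∈ parameterBox n k η := by
    intro α hα Q hQ τ hτ hle
    obtain ⟨σ, hσ⟩ := hgap.exists_perm hδ hδ1 hn hnk hbal hκ₁ hκ₂ hα hQ hτ (hV ▸ hle)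
    have h1 := (mul_le_mul_of_nonneg_left (sub_le_sub_right hle _)
      (by positivity : (0 : ℝ) ≤ 2 ^ n)).trans (le_complete_logLik hα hτ hQ hσ)
    have hemp' : empiricalQ (adjacency x) (σ ∘ z₀) ∈ connectionSpace k := by
      have h2 : ∀ a b, empiricalQ (adjacency x) (σ ∘ z₀) a b
          = empiricalQ (adjacency x) z₀ (σ.symm a) (σ.symm b) := fun a b => by
        rw [← empiricalQ_perm_comp (adjacency x) z₀ σ, σ.apply_symm_apply, σ.apply_symm_apply]
      refine ⟨Matrix.IsSymm.ext fun a b => ?_, fun a b => ?_⟩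
      · rw [h2, h2, hemp.1.apply]
      · rw [h2]; exact hemp.2 _ _
    obtain ⟨h3, h4⟩ := exp_le_of_le_complete_logLik hα hQ hemp' h1
    rw [← hη] at h3 h4
    exact mem_parameterBox hα hQ hτ h3 h4
  have hmem := hbox _ hprop _ hemp _ (pointMass_mem z₀) hV.le
  obtain ⟨p, hp, hmax⟩ := (isCompact_parameterBox η).exists_isMaxOn ⟨_, hmem⟩
    (continuousOn_objective (adjacency x) hη0)
  obtain ⟨h1, h2, h3⟩ := of_mem_parameterBox hη0 hp
  rw [isMaxOn_iff] at hmax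
  refine ⟨p.2.1, p.2.2, p.1, h2, h3, h1, fun α hα Q hQ τ hτ => ?_⟩
  rcases le_total V (objective (adjacency x) τ α Q) with h | h
  · exact hmax _ (hbox α hα Q hQ τ hτ h)
  · have h5 := hmax _ hmem
    dsimp only at h5
    exact h.trans (hV.trans_le h5)

theorem HasLikelihoodGap.eq_perm_comp_of_isVariationalLabels
    (hgap : HasLikelihoodGap (adjacency x) z₀ κ)
    (hδ : 0 < δ) (hδ1 : δ ≤ 1) (hn : 16 ≤ δ * n) (hnk : 2 * k < n) (hbal : IsBalanced δ z₀)
    (hκ₁ : 32 * Real.log (1 / δ) / δ ^ 2 < κ)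
    (hκ₂ : k * (1 / δ + Real.log (1 / δ)) + 2 + 2 * Real.log n ≤ κ * δ / 4)
    (hemp : empiricalQ (adjacency x) z₀ ∈ connectionSpace k) {z : Labels n k}
    (hz : IsVariationalLabels (adjacency x) z) : ∃ σ : Equiv.Perm (Fin k), z = σ ∘ z₀ := by
  obtain ⟨α, Q, τ, ⟨hα, hQ, hτ, hmax⟩, hargmax⟩ := hz
  have hprop := empiricalProportions_mem hδ (by omega) hbal
  obtain ⟨σ, hσ⟩ := hgap.exists_perm hδ hδ1 hn hnk hbal hκ₁ hκ₂ hα hQ hτ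
    (hmax _ hprop _ hemp _ (pointMass_mem z₀))
  refine ⟨σ, funext fun i => ?_⟩
  by_contra hne
  -- A label with mass above `1/2` is the only maximizer, so the choice of argmax plays no role.
  linarith [hσ i, hargmax i ((σ ∘ z₀) i), add_le_one_of_mem_stdSimplex (hτ i) hne]

theorem HasLikelihoodGap.exists_isVariationalLabels
    (hgap : HasLikelihoodGap (adjacency x) z₀ κ)
    (hδ : 0 < δ) (hδ1 : δ ≤ 1) (hn : 16 ≤ δ * n) (hnk : 2 * k < n) (hbal : IsBalanced δ z₀)
    (hκ₁ : 32 * Real.log (1 / δ) / δ ^ 2 < κ)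
    (hκ₂ : k * (1 / δ + Real.log (1 / δ)) + 2 + 2 * Real.log n ≤ κ * δ / 4)
    (hemp : empiricalQ (adjacency x) z₀ ∈ connectionSpace k) :
    ∃ z : Labels n k, IsVariationalLabels (adjacency x) z := by
  obtain ⟨α, Q, τ, h⟩ := hgap.exists_isVariational hδ hδ1 hn hnk hbal hκ₁ hκ₂ hemp
  have hne : Nonempty (Fin k) := ⟨z₀ ⟨0, by omega⟩⟩
  choose z hz using fun i => Finite.exists_max (τ i)
  exact ⟨z, α, Q, τ, h, hz⟩

end Recovery

/-! ### Identifiability of the labels -/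

section Identifiability

variable {n k : ℕ}

/-- The squared distance between the `i`-th rows of two block matrices, off the diagonal. -/
noncomputable def rowDistSq (S s : Matrix (Fin k) (Fin k) ℝ) (z z₀ : Labels n k) (i : Fin n) :
    ℝ :=
  ∑ j ∈ Finset.univ.erase i, (S (z i) (z j) - s (z₀ i) (z₀ j)) ^ 2

theorem rowDistSq_nonneg (S s : Matrix (Fin k) (Fin k) ℝ) (z z₀ : Labels n k) (i : Fin n) :
    0 ≤ rowDistSq S s z z₀ i :=
  Finset.sum_nonneg fun _ _ => sq_nonneg _

/-- Two nodes merged by `z` have the same row of `S`, which cannot be close to two rows of `s` that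
differ at all nodes of some community `c`. -/
theorem rowDistSq_add_ge {S s : Matrix (Fin k) (Fin k) ℝ} {z z₀ : Labels n k} {γ δ : ℝ}
    (hγ : 0 < γ) (hs : ∀ a b, a ≠ b → ∃ c, γ ≤ (s a c - s b c) ^ 2) (hn : 4 ≤ δ * n)
    (hbal : IsBalanced δ z₀) {i i' : Fin n} (hz : z i = z i') (hz₀ : z₀ i ≠ z₀ i') :
    γ * δ * n / 4 ≤ rowDistSq S s z z₀ i + rowDistSq S s z z₀ i' := by
  obtain ⟨c, hc⟩ := hs _ _ hz₀
  set C := ((community z₀ c).erase i).erase i' with hC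
  have hcard : δ * n - 2 ≤ C.card := by
    have h1 := Finset.pred_card_le_card_erase (s := community z₀ c) (a := i)
    have h2 := Finset.pred_card_le_card_erase (s := (community z₀ c).erase i) (a := i')
    have h3 : (community z₀ c).card ≤ C.card + 2 := by rw [hC]; omega
    have h4 : ((community z₀ c).card : ℝ) ≤ C.card + 2 := by exact_mod_cast h3
    linarith [hbal c]
  have h1 : ∑ j ∈ C, (S (z i) (z j) - s (z₀ i) (z₀ j)) ^ 2 ≤ rowDistSq S s z z₀ i :=
    Finset.sum_le_sum_of_subset_of_nonneg
      (fun j hj => by simp only [hC, Finset.mem_erase] at hj; simp [hj.2.1])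
      fun _ _ _ => sq_nonneg _
  have h2 : ∑ j ∈ C, (S (z i') (z j) - s (z₀ i') (z₀ j)) ^ 2 ≤ rowDistSq S s z z₀ i' :=
    Finset.sum_le_sum_of_subset_of_nonneg
      (fun j hj => by simp only [hC, Finset.mem_erase] at hj; simp [hj.1])
      fun _ _ _ => sq_nonneg _
  have h3 : ∑ j ∈ C, γ / 2 ≤ ∑ j ∈ C, ((S (z i) (z j) - s (z₀ i) (z₀ j)) ^ 2
      + (S (z i') (z j) - s (z₀ i') (z₀ j)) ^ 2) := by
    refine Finset.sum_le_sum fun j hj => ?_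
    simp only [hC, Finset.mem_erase, mem_community] at hj
    rw [hj.2.2, hz]
    -- Parallelogram inequality: the squared distances of one point to two others sum to at least
    -- half the squared distance between those two.
    nlinarith [sq_nonneg ((S (z i') (z j) - s (z₀ i) c) + (S (z i') (z j) - s (z₀ i') c))]
  rw [Finset.sum_add_distrib, Finset.sum_const, nsmul_eq_mul] at h3
  have h4 := mul_le_mul_of_nonneg_right hcard (by linarith : 0 ≤ γ / 2)
  nlinarith

theorem hammingDist_le_card {z z' : Labels n k} : hammingDist z z' ≤ n := by
  simpa using hammingDist_le_card_fintype (x := z) (y := z')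

/-- If the rows of `s` are distinct, a block matrix with labels `z` is far from the one with
labels `z₀`, unless `z` agrees with `z₀` up to a permutation of the labels. -/
theorem exists_perm_hammingDist_le {S s : Matrix (Fin k) (Fin k) ℝ} (z : Labels n k)
    {z₀ : Labels n k} {γ δ : ℝ}
    (hγ : 0 < γ) (hδ : 0 < δ) (hδ1 : δ ≤ 1)
    (hs : ∀ a b, a ≠ b → ∃ c, γ ≤ (s a c - s b c) ^ 2) (hn : 4 ≤ δ * n)
    (hbal : IsBalanced δ z₀) :
    ∃ σ : Equiv.Perm (Fin k),
      γ * δ ^ 2 / 8 * n * hammingDist z (σ ∘ z₀) ≤ ∑ i, rowDistSq S s z z₀ i := by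
  -- Half the bound of `rowDistSq_add_ge`: two nodes with row distance below `t` and different true
  -- labels cannot be merged by `z`.
  set t := γ * δ * n / 8 with ht
  have ht0 : 0 ≤ t := by positivity
  set bad : Finset (Fin n) := {i | t ≤ rowDistSq S s z z₀ i} with hbad
  have hsum : bad.card * t ≤ ∑ i, rowDistSq S s z z₀ i := by
    calc bad.card * t = ∑ i ∈ bad, t := by rw [Finset.sum_const, nsmul_eq_mul]
      _ ≤ ∑ i ∈ bad, rowDistSq S s z z₀ i :=
        Finset.sum_le_sum fun i hi => by simpa [hbad] using hi
      _ ≤ _ := Finset.sum_le_sum_of_subset_of_nonneg (Finset.subset_univ _)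
        fun i _ _ => rowDistSq_nonneg S s z z₀ i
  have hgood : ∀ {i i'}, i ∉ bad → i' ∉ bad → z i = z i' → z₀ i = z₀ i' := by
    intro i i' hi hi' h
    by_contra hne
    have := rowDistSq_add_ge (S := S) hγ hs hn hbal h hne
    simp only [hbad, Finset.mem_filter, Finset.mem_univ, true_and, not_le] at hi hi'
    linarith
  -- With this many bad rows the trivial bound `n` on the Hamming distance suffices, and any
  -- permutation will do.
  rcases le_or_gt (δ * n) (bad.card : ℝ) with hcase | hcase
  · refine ⟨1, le_trans ?_ hsum⟩
    have h1 : (hammingDist z ((1 : Equiv.Perm (Fin k)) ∘ z₀) : ℝ) ≤ n := by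
      exact_mod_cast hammingDist_le_card
    calc γ * δ ^ 2 / 8 * n * (hammingDist z ((1 : Equiv.Perm (Fin k)) ∘ z₀) : ℝ)
        ≤ γ * δ ^ 2 / 8 * n * n := mul_le_mul_of_nonneg_left h1 (by positivity)
      _ = δ * n * t := by rw [ht]; ring
      _ ≤ bad.card * t := mul_le_mul_of_nonneg_right hcase ht0
  -- There are too few bad nodes to fill a community. The labels that `z` gives to good
  -- representatives define the permutation, and only bad nodes can violate it.
  · have hex : ∀ b, ∃ g, z₀ g = b ∧ g ∉ bad := by
      intro b
      by_contra! h
      have h1 : community z₀ b ⊆ bad := fun g hg => h g (mem_community.1 hg)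
      have h2 : ((community z₀ b).card : ℝ) ≤ bad.card := by
        exact_mod_cast Finset.card_le_card h1
      linarith [hbal b]
    choose g hg hgb using hex
    have hinj : Function.Injective fun b => z (g b) := fun b b' h => by
      rw [← hg b, ← hg b']
      exact hgood (hgb b) (hgb b') h
    have hbij := Finite.injective_iff_bijective.1 hinj
    refine ⟨Equiv.ofBijective _ hbij, le_trans ?_ hsum⟩
    have hham : hammingDist z (Equiv.ofBijective _ hbij ∘ z₀) ≤ bad.card := by
      refine Finset.card_le_card fun i hi => ?_
      by_contra hib
      refine (Finset.mem_filter.1 hi).2 ?_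
      obtain ⟨b, hb⟩ := hbij.2 (z i)
      have h1 : z₀ i = b := by
        rw [← hg b]
        exact hgood hib (hgb b) hb.symm
      simp only [Function.comp_apply, Equiv.ofBijective_apply, h1]
      exact hb.symm
    have hham' : (hammingDist z (Equiv.ofBijective _ hbij ∘ z₀) : ℝ) ≤ bad.card := by
      exact_mod_cast hham
    calc γ * δ ^ 2 / 8 * n * (hammingDist z (Equiv.ofBijective _ hbij ∘ z₀) : ℝ)
        ≤ γ * δ ^ 2 / 8 * n * bad.card := mul_le_mul_of_nonneg_left hham' (by positivity)
      _ = δ * (bad.card * t) := by rw [ht]; ring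
      _ ≤ 1 * (bad.card * t) := mul_le_mul_of_nonneg_right hδ1 (by positivity)
      _ = bad.card * t := one_mul _

end Identifiability

/-! ### Sums over pairs and blocks -/

section Blocks

variable {n k : ℕ}

theorem two_mul_sum_nodePair (f : Fin n → Fin n → ℝ) (hf : ∀ i j, f i j = f j i) :
    2 * ∑ e : NodePair n, f e.1.1 e.1.2
      = ∑ p ∈ (Finset.univ : Finset (Fin n × Fin n)) with p.1 ≠ p.2, f p.1 p.2 := by
  have h1 : ∑ e : NodePair n, f e.1.1 e.1.2
      = ∑ p ∈ (Finset.univ : Finset (Fin n × Fin n)) with p.1 < p.2, f p.1 p.2 :=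
    (Finset.sum_subtype _ (by simp) fun p : Fin n × Fin n => f p.1 p.2).symm
  have h2 : ∑ p ∈ (Finset.univ : Finset (Fin n × Fin n)) with p.2 < p.1, f p.1 p.2
      = ∑ p ∈ (Finset.univ : Finset (Fin n × Fin n)) with p.1 < p.2, f p.1 p.2 :=
    Finset.sum_nbij' Prod.swap Prod.swap (by simp) (by simp) (by simp) (by simp)
      fun p _ => hf _ _
  have h3 : ((Finset.univ : Finset (Fin n × Fin n)).filter fun p => p.1 ≠ p.2)
      = (Finset.univ.filter fun p => p.1 < p.2) ∪ Finset.univ.filter fun p => p.2 < p.1 := by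
    ext p; simp [lt_or_lt_iff_ne]
  rw [h3, Finset.sum_union, h2, h1, two_mul]
  rw [Finset.disjoint_filter]
  exact fun p _ h => h.not_gt

theorem sum_block (z : Labels n k) (f : Fin n × Fin n → ℝ) :
    ∑ a, ∑ b, ∑ p ∈ block z a b, f p
      = ∑ p ∈ (Finset.univ : Finset (Fin n × Fin n)) with p.1 ≠ p.2, f p := by
  rw [← Finset.sum_fiberwise (s := Finset.univ.filter fun p : Fin n × Fin n => p.1 ≠ p.2)
    (g := fun p => (z p.1, z p.2)), ← Finset.univ_product_univ, Finset.sum_product]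
  refine Finset.sum_congr rfl fun a _ => Finset.sum_congr rfl fun b _ => ?_
  refine Finset.sum_congr ?_ fun _ _ => rfl
  ext p
  simp [block]
  tauto

theorem mem_block {z : Labels n k} {a b : Fin k} {p : Fin n × Fin n} :
    p ∈ block z a b ↔ z p.1 = a ∧ z p.2 = b ∧ p.1 ≠ p.2 := by simp [block]

theorem two_mul_sum_nodePair_eq_sum_block (z : Labels n k) (f : Fin n → Fin n → ℝ)
    (hf : ∀ i j, f i j = f j i) :
    2 * ∑ e : NodePair n, f e.1.1 e.1.2 = ∑ a, ∑ b, ∑ p ∈ block z a b, f p.1 p.2 := by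
  rw [two_mul_sum_nodePair f hf, sum_block z fun p => f p.1 p.2]

theorem sum_rowDistSq (S s : Matrix (Fin k) (Fin k) ℝ) (z z₀ : Labels n k) (hS : S.IsSymm)
    (hs : s.IsSymm) :
    ∑ i, rowDistSq S s z z₀ i
      = 2 * ∑ e : NodePair n, (S (z e.1.1) (z e.1.2) - s (z₀ e.1.1) (z₀ e.1.2)) ^ 2 := by
  rw [two_mul_sum_nodePair (fun i j => (S (z i) (z j) - s (z₀ i) (z₀ j)) ^ 2)
    fun i j => by rw [hS.apply, hs.apply], Finset.sum_filter, ← Finset.univ_product_univ,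
    Finset.sum_product]
  refine Finset.sum_congr rfl fun i _ => ?_
  rw [← Finset.sum_filter, rowDistSq]
  refine Finset.sum_congr ?_ fun _ _ => rfl
  ext j
  simp [eq_comm]

theorem sum_block_swap (z : Labels n k) (f : Fin n → Fin n → ℝ) (hf : ∀ i j, f i j = f j i)
    (a b : Fin k) : ∑ p ∈ block z a b, f p.1 p.2 = ∑ p ∈ block z b a, f p.1 p.2 := by
  refine Finset.sum_nbij' Prod.swap Prod.swap ?_ ?_ (by simp) (by simp) fun p _ => hf _ _
  all_goals
    intro p
    simp only [mem_block, Prod.fst_swap, Prod.snd_swap]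
    exact fun h => ⟨h.2.1, h.1, h.2.2.symm⟩

theorem card_block_swap (z : Labels n k) (a b : Fin k) :
    ((block z a b).card : ℝ) = (block z b a).card := by
  have := sum_block_swap z (fun _ _ => (1 : ℝ)) (fun _ _ => rfl) a b
  simpa using this

end Blocks

/-! ### The empirical connection probabilities -/

section Empirical

variable {n k : ℕ} (x : Edges n) (z : Labels n k)

theorem empiricalQ_isSymm : (empiricalQ (adjacency x) z).IsSymm :=
  Matrix.IsSymm.ext fun a b => by
    simp only [empiricalQ]
    rw [sum_block_swap z _ (adjacency_symm x), card_block_swap]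

theorem sum_adjacency_nonneg (s : Finset (Fin n × Fin n)) :
    0 ≤ ∑ p ∈ s, adjacency x p.1 p.2 :=
  Finset.sum_nonneg fun _ _ => adjacency_nonneg x _ _

theorem sum_adjacency_le_card (s : Finset (Fin n × Fin n)) :
    ∑ p ∈ s, adjacency x p.1 p.2 ≤ s.card := by
  calc _ ≤ ∑ p ∈ s, (1 : ℝ) := Finset.sum_le_sum fun _ _ => adjacency_le_one x _ _
    _ = _ := by simp

theorem empiricalQ_nonneg (a b : Fin k) : 0 ≤ empiricalQ (adjacency x) z a b :=
  div_nonneg (sum_adjacency_nonneg x _) (Nat.cast_nonneg _)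

theorem empiricalQ_le_one (a b : Fin k) : empiricalQ (adjacency x) z a b ≤ 1 :=
  div_le_one_of_le₀ (sum_adjacency_le_card x _) (Nat.cast_nonneg _)

variable {x z}

theorem empiricalQ_pos {i j : Fin n} (hij : i ≠ j) (h : adjacency x i j = 1) :
    0 < empiricalQ (adjacency x) z (z i) (z j) := by
  have hmem : (i, j) ∈ block z (z i) (z j) := by simp [mem_block, hij]
  refine div_pos ?_ (by exact_mod_cast Finset.card_pos.2 ⟨_, hmem⟩)
  have := Finset.single_le_sum (f := fun p : Fin n × Fin n => adjacency x p.1 p.2)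
    (fun p _ => adjacency_nonneg x p.1 p.2) hmem
  simp only [h] at this
  linarith

theorem empiricalQ_lt_one {i j : Fin n} (hij : i ≠ j) (h : adjacency x i j = 0) :
    empiricalQ (adjacency x) z (z i) (z j) < 1 := by
  have hmem : (i, j) ∈ block z (z i) (z j) := by simp [mem_block, hij]
  rw [empiricalQ, div_lt_one (by exact_mod_cast Finset.card_pos.2 ⟨_, hmem⟩),
    ← Finset.add_sum_erase _ _ hmem]
  have h1 := sum_adjacency_le_card x ((block z (z i) (z j)).erase (i, j))
  have h2 : (((block z (z i) (z j)).erase (i, j)).card : ℝ) < (block z (z i) (z j)).card := by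
    exact_mod_cast Finset.card_erase_lt_of_mem hmem
  simp only [h]
  linarith

/-- Gibbs' inequality for two Bernoulli laws. The cases `M = 0`, `M = N` and `N = 0` are included,
with `log 0 = 0` and `0 / 0 = 0`. -/
theorem mul_log_add_mul_log_le {M N q : ℝ} (hM : 0 ≤ M) (hMN : M ≤ N) (hq : 0 < q)
    (hq1 : q < 1) :
    M * Real.log q + (N - M) * Real.log (1 - q)
      ≤ M * Real.log (M / N) + (N - M) * Real.log (1 - M / N) := by
  rcases (hM.trans hMN).eq_or_lt with h | hN
  · have : M = 0 := le_antisymm (h ▸ hMN) hM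
    simp [this, ← h]
  have h1 := mul_log_sub_log_le (div_nonneg hM hN.le) hq
  have h2 := mul_log_sub_log_le (sub_nonneg.2 (div_le_one_of_le₀ hMN hN.le)) (sub_pos.2 hq1)
  obtain ⟨m, rfl⟩ : ∃ m, M = N * m := ⟨M / N, by field_simp⟩
  rw [mul_div_cancel_left₀ _ hN.ne'] at h1 h2 ⊢
  nlinarith

/-- For given labels, the empirical connection probabilities maximize the likelihood. -/
theorem logLik_le_logLik_empiricalQ {Q : Matrix (Fin k) (Fin k) ℝ} (hQ : Q ∈ connectionSpace k) :
    logLik (adjacency x) z Q ≤ logLik (adjacency x) z (empiricalQ (adjacency x) z) := by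
  have key : ∀ Q : Matrix (Fin k) (Fin k) ℝ, Q.IsSymm → 2 * logLik (adjacency x) z Q
      = ∑ a, ∑ b, ((∑ p ∈ block z a b, adjacency x p.1 p.2) * Real.log (Q a b)
        + ((block z a b).card - ∑ p ∈ block z a b, adjacency x p.1 p.2)
          * Real.log (1 - Q a b)) := by
    intro Q hQ
    rw [logLik, two_mul_sum_nodePair_eq_sum_block z (fun i j =>
      adjacency x i j * Real.log (Q (z i) (z j))
        + (1 - adjacency x i j) * Real.log (1 - Q (z i) (z j)))
      fun i j => by rw [adjacency_symm, hQ.apply]]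
    refine Finset.sum_congr rfl fun a _ => Finset.sum_congr rfl fun b _ => ?_
    have : ((block z a b).card : ℝ) - ∑ p ∈ block z a b, adjacency x p.1 p.2
        = ∑ p ∈ block z a b, (1 - adjacency x p.1 p.2) := by
      rw [Finset.sum_sub_distrib]; simp
    rw [this, Finset.sum_mul, Finset.sum_mul, ← Finset.sum_add_distrib]
    refine Finset.sum_congr rfl fun p hp => ?_
    rw [mem_block] at hp
    rw [hp.1, hp.2.1]
  have h : 2 * logLik (adjacency x) z Q
      ≤ 2 * logLik (adjacency x) z (empiricalQ (adjacency x) z) := by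
    rw [key Q hQ.1, key _ (empiricalQ_isSymm x z)]
    exact Finset.sum_le_sum fun a _ => Finset.sum_le_sum fun b _ =>
      mul_log_add_mul_log_le (sum_adjacency_nonneg x _) (sum_adjacency_le_card x _)
        (hQ.2 a b).1 (hQ.2 a b).2
  linarith

end Empirical

/-! ### Weights of networks -/

section Weights

variable {n k : ℕ}

/-- The probability of the network `x` when edges are independent and `Θ e` is the probability of
the edge `e`. -/
def edgeWeight (Θ : NodePair n → ℝ) (x : Edges n) : ℝ :=
  ∏ e, if x e then Θ e else 1 - Θ e

/-- The connection probability of a pair of nodes. -/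
def pairProb (z : Labels n k) (Q : Matrix (Fin k) (Fin k) ℝ) (e : NodePair n) : ℝ :=
  Q (z e.1.1) (z e.1.2)

/-- The hypotheses allow probabilities `0` and `1` where the network is compatible with them: the
factor in front of `log 0` is then zero. Empirical matrices need this. -/
theorem exp_logLik_eq_edgeWeight {x : Edges n} {z : Labels n k} {Q : Matrix (Fin k) (Fin k) ℝ}
    (h1 : ∀ e, x e = true → 0 < pairProb z Q e) (h2 : ∀ e, x e = false → pairProb z Q e < 1) :
    Real.exp (logLik (adjacency x) z Q) = edgeWeight (pairProb z Q) x := by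
  rw [logLik, Real.exp_sum, edgeWeight]
  refine Finset.prod_congr rfl fun e _ => ?_
  rw [adjacency_pair]
  cases h : x e with
  | true => simp [Real.exp_log (h1 e h), show Q (z e.1.1) (z e.1.2) = pairProb z Q e from rfl]
  | false =>
    simp [Real.exp_log (sub_pos.2 (h2 e h)),
      show Q (z e.1.1) (z e.1.2) = pairProb z Q e from rfl]

theorem exp_logLik_of_mem_connectionSpace {x : Edges n} {z : Labels n k}
    {Q : Matrix (Fin k) (Fin k) ℝ} (hQ : Q ∈ connectionSpace k) :
    Real.exp (logLik (adjacency x) z Q) = edgeWeight (pairProb z Q) x :=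
  exp_logLik_eq_edgeWeight (fun _ _ => (hQ.2 _ _).1) fun _ _ => (hQ.2 _ _).2

theorem exp_logLik_empiricalQ (x : Edges n) (z : Labels n k) :
    Real.exp (logLik (adjacency x) z (empiricalQ (adjacency x) z))
      = edgeWeight (pairProb z (empiricalQ (adjacency x) z)) x := by
  refine exp_logLik_eq_edgeWeight (fun e he => ?_) fun e he => ?_
  · exact empiricalQ_pos e.2.ne (by rw [adjacency_pair, he]; rfl)
  · exact empiricalQ_lt_one e.2.ne (by rw [adjacency_pair, he]; rfl)

/-- A finite set of matrices that contains all possible matrices of empirical connection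
probabilities. -/
noncomputable def empiricalGrid (n k : ℕ) : Finset (Matrix (Fin k) (Fin k) ℝ) := by
  classical
  exact (Fintype.piFinset fun _ => Fintype.piFinset fun _ =>
    (Finset.range (n ^ 2 + 1) ×ˢ Finset.range (n ^ 2 + 1)).image
      fun p : ℕ × ℕ => (p.1 : ℝ) / p.2).filter
        fun Q : Matrix (Fin k) (Fin k) ℝ => Q.IsSymm ∧ ∀ a b, 0 ≤ Q a b ∧ Q a b ≤ 1

theorem card_empiricalGrid_le (n k : ℕ) : (empiricalGrid n k).card ≤ (n ^ 2 + 1) ^ (2 * k ^ 2) := by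
  classical
  unfold empiricalGrid
  have hc : ∀ t : Finset ℝ, (Fintype.piFinset fun _ : Fin k =>
      Fintype.piFinset fun _ : Fin k => t).card = (t.card ^ k) ^ k := fun t => by simp
  refine (Finset.card_filter_le _ _).trans ((hc _).trans_le ?_)
  rw [← pow_mul]
  have h := Finset.card_image_le (s := Finset.range (n ^ 2 + 1) ×ˢ Finset.range (n ^ 2 + 1))
    (f := fun p : ℕ × ℕ => (p.1 : ℝ) / p.2)
  rw [Finset.card_product, Finset.card_range] at h
  calc _ ≤ ((n ^ 2 + 1) * (n ^ 2 + 1)) ^ (k * k) := Nat.pow_le_pow_left h _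
    _ = _ := by rw [← sq, ← pow_mul, sq k]

theorem empiricalQ_mem_empiricalGrid (x : Edges n) (z : Labels n k) :
    empiricalQ (adjacency x) z ∈ empiricalGrid n k := by
  classical
  unfold empiricalGrid
  refine Finset.mem_filter.2 ⟨?_, empiricalQ_isSymm x z, fun a b =>
    ⟨empiricalQ_nonneg x z a b, empiricalQ_le_one x z a b⟩⟩
  refine Fintype.mem_piFinset.2 fun a => Fintype.mem_piFinset.2 fun b => Finset.mem_image.2 ?_
  have hle : (block z a b).card ≤ n ^ 2 := by
    have := Finset.card_le_univ (block z a b)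
    simpa [sq] using this
  -- The denominator may be zero: an empty block has empirical value `0 / 0 = 0`, and this pair is
  -- in the grid.
  refine ⟨(((block z a b).filter fun p => adjacency x p.1 p.2 = 1).card, (block z a b).card),
    ?_, ?_⟩
  · rw [Finset.mem_product, Finset.mem_range, Finset.mem_range]
    exact ⟨Nat.lt_succ_of_le ((Finset.card_filter_le _ _).trans hle), Nat.lt_succ_of_le hle⟩
  · simp only [empiricalQ]
    congr 1
    rw [Finset.card_filter, Nat.cast_sum]
    refine Finset.sum_congr rfl fun p _ => ?_
    rcases adjacency_eq_zero_or_one x p.1 p.2 with h | h <;> simp [h]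

theorem isSymm_of_mem_empiricalGrid {Q : Matrix (Fin k) (Fin k) ℝ}
    (h : Q ∈ empiricalGrid n k) : Q.IsSymm := by
  classical
  unfold empiricalGrid at h
  exact (Finset.mem_filter.1 h).2.1

theorem bounds_of_mem_empiricalGrid {Q : Matrix (Fin k) (Fin k) ℝ}
    (h : Q ∈ empiricalGrid n k) (a b : Fin k) : 0 ≤ Q a b ∧ Q a b ≤ 1 := by
  classical
  unfold empiricalGrid at h
  exact (Finset.mem_filter.1 h).2.2 a b

end Weights

/-! ### Probabilities as finite sums -/

/-- Markov's inequality for a measure on a finite set. -/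
theorem measure_le_ofReal_sum {Ω : Type*} [Fintype Ω] [MeasurableSpace Ω]
    [MeasurableSingletonClass Ω] {μ : Measure Ω} {w f : Ω → ℝ}
    (hμ : ∀ ω, μ {ω} = ENNReal.ofReal (w ω)) (hw : ∀ ω, 0 ≤ w ω) (hf : ∀ ω, 0 ≤ f ω)
    {S : Set Ω} (hS : ∀ ω ∈ S, 1 ≤ f ω) : μ S ≤ ENNReal.ofReal (∑ ω, w ω * f ω) := by
  classical
  have h1 : μ S = ∑ ω ∈ S.toFinset, μ {ω} := by
    rw [sum_measure_singleton, Set.coe_toFinset]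
  rw [h1, ENNReal.ofReal_sum_of_nonneg fun ω _ => mul_nonneg (hw ω) (hf ω)]
  refine le_trans (Finset.sum_le_sum fun ω hω => ?_)
    (Finset.sum_le_sum_of_subset_of_nonneg (Finset.subset_univ S.toFinset) fun _ _ _ => zero_le)
  rw [hμ]
  exact ENNReal.ofReal_le_ofReal (le_mul_of_one_le_right (hw ω) (hS ω (Set.mem_toFinset.1 hω)))

section Laws

variable {n k : ℕ}

theorem edgeLaw_singleton {q : ℝ} (h0 : 0 ≤ q) (h1 : q ≤ 1) (b : Bool) :
    edgeLaw q {b} = ENNReal.ofReal (if b then q else 1 - q) := by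
  have hp : ((Set.projIcc (0 : ℝ) 1 zero_le_one q : unitInterval) : ℝ) = q := by
    rw [Set.projIcc_of_mem zero_le_one ⟨h0, h1⟩]
  unfold edgeLaw
  cases b with
  | true =>
    rw [bernoulliMeasure_apply_of_mem_of_notMem _ (MeasurableSet.of_discrete) (by simp) (by simp)]
    simp only [if_true]
    rw [← ENNReal.ofReal_coe_nnreal, unitInterval.coe_toNNReal, hp]
  | false =>
    rw [bernoulliMeasure_apply_of_notMem_of_mem _ (MeasurableSet.of_discrete) (by simp) (by simp)]
    rw [← ENNReal.ofReal_coe_nnreal, unitInterval.coe_toNNReal, unitInterval.coe_symm_eq, hp]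
    simp

theorem edgeWeight_nonneg {Θ : NodePair n → ℝ} (hΘ : ∀ e, 0 ≤ Θ e ∧ Θ e ≤ 1) (x : Edges n) :
    0 ≤ edgeWeight Θ x := by
  refine Finset.prod_nonneg fun e _ => ?_
  split_ifs
  · exact (hΘ e).1
  · linarith [(hΘ e).2]

theorem edgesLaw_singleton {Q : Matrix (Fin k) (Fin k) ℝ} (hQ : ∀ a b, 0 ≤ Q a b ∧ Q a b ≤ 1)
    (z : Labels n k) (x : Edges n) :
    edgesLaw Q z {x} = ENNReal.ofReal (edgeWeight (pairProb z Q) x) := by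
  rw [edgesLaw, Measure.pi_singleton, edgeWeight, ENNReal.ofReal_prod_of_nonneg]
  · exact Finset.prod_congr rfl fun e _ => edgeLaw_singleton (hQ _ _).1 (hQ _ _).2 _
  · intro e _
    split_ifs
    · exact (hQ _ _).1
    · exact sub_nonneg.2 (hQ _ _).2

theorem edgesLaw_le {Q : Matrix (Fin k) (Fin k) ℝ} (hQ : ∀ a b, 0 ≤ Q a b ∧ Q a b ≤ 1)
    (z : Labels n k) {f : Edges n → ℝ} (hf : ∀ x, 0 ≤ f x) {S : Set (Edges n)}
    (hS : ∀ x ∈ S, 1 ≤ f x) :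
    edgesLaw Q z S ≤ ENNReal.ofReal (∑ x, edgeWeight (pairProb z Q) x * f x) :=
  measure_le_ofReal_sum (edgesLaw_singleton hQ z) (edgeWeight_nonneg fun _ => hQ _ _) hf hS

theorem labelLaw_singleton {α : Fin k → ℝ} (a : Fin k) :
    labelLaw α {a} = ENNReal.ofReal (α a) := by
  simp only [labelLaw, Measure.coe_finsetSum, Finset.sum_apply, Measure.smul_apply, smul_eq_mul]
  rw [Finset.sum_eq_single a]
  · simp
  · intro b _ hb
    simp [hb]
  · simp

/-- The joint law of the labels. -/
noncomputable def labelsLaw (n : ℕ) {k : ℕ} (α : Fin k → ℝ) : Measure (Labels n k) :=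
  Measure.pi fun _ => labelLaw α

theorem labelsLaw_le {α : Fin k → ℝ} (hα : α ∈ stdSimplex ℝ (Fin k)) {f : Labels n k → ℝ}
    (hf : ∀ z, 0 ≤ f z) {S : Set (Labels n k)} (hS : ∀ z ∈ S, 1 ≤ f z) :
    labelsLaw n α S ≤ ENNReal.ofReal (∑ z : Labels n k, (∏ i, α (z i)) * f z) := by
  have := isProbabilityMeasure_labelLaw hα
  refine measure_le_ofReal_sum (fun z => ?_) (fun z => Finset.prod_nonneg fun i _ => hα.1 _) hf hS
  rw [labelsLaw, Measure.pi_singleton, ENNReal.ofReal_prod_of_nonneg fun i _ => hα.1 _]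
  exact Finset.prod_congr rfl fun i _ => labelLaw_singleton _

/-- A bound for the joint law in terms of a bound for the conditional laws given the labels. -/
theorem sbmLaw_le_add {α : Fin k → ℝ} (hα : α ∈ stdSimplex ℝ (Fin k))
    (Q : Matrix (Fin k) (Fin k) ℝ) {G : Set (Labels n k)} {S : Set (Labels n k × Edges n)}
    {ε : ENNReal} (h : ∀ z ∈ G, edgesLaw Q z {x | (z, x) ∈ S} ≤ ε) :
    sbmLaw n α Q S ≤ labelsLaw n α Gᶜ + ε := by
  classical
  have := isProbabilityMeasure_labelLaw hα
  have : IsProbabilityMeasure (labelsLaw n α) := by unfold labelsLaw; infer_instance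
  have : IsMarkovKernel (Kernel.ofFunOfCountable fun z : Labels n k => edgesLaw Q z) :=
    ⟨fun z => inferInstanceAs (IsProbabilityMeasure (edgesLaw Q z))⟩
  have hS : MeasurableSet S := S.toFinite.measurableSet
  have hG : MeasurableSet Gᶜ := (Gᶜ).toFinite.measurableSet
  rw [sbmLaw, Measure.compProd_apply hS]
  calc _ ≤ ∫⁻ z, (Gᶜ.indicator 1 z + ε) ∂labelsLaw n α := by
        refine lintegral_mono fun z => ?_
        by_cases hz : z ∈ G
        · exact (h z hz).trans le_add_self
        · have h1 : edgesLaw Q z {x | (z, x) ∈ S} ≤ 1 := prob_le_one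
          refine h1.trans ?_
          rw [Set.indicator_of_mem (show z ∈ Gᶜ from hz)]
          exact le_self_add
    _ = _ := by
        rw [lintegral_add_right _ measurable_const, lintegral_indicator_one hG, lintegral_const,
          measure_univ, mul_one]

end Laws

/-! ### Second moments of block sums -/

section SecondMoment

variable {n k : ℕ}

/-- The law of a single edge. -/
def edgeMass (Θ : NodePair n → ℝ) (e : NodePair n) (b : Bool) : ℝ := if b then Θ e else 1 - Θ e

theorem edgeWeight_eq (Θ : NodePair n → ℝ) (x : Edges n) :
    edgeWeight Θ x = ∏ e, edgeMass Θ e (x e) := rfl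

theorem sum_edgeMass (Θ : NodePair n → ℝ) (e : NodePair n) : ∑ b, edgeMass Θ e b = 1 := by
  simp [edgeMass]

/-- An edge indicator minus its expectation. -/
def centered (Θ : NodePair n → ℝ) (e : NodePair n) (b : Bool) : ℝ := (if b then 1 else 0) - Θ e

/-- Variance of a weighted sum of independent centered Bernoulli variables: the cross terms vanish.
-/
theorem sum_edgeWeight_mul_sq (Θ m : NodePair n → ℝ) :
    ∑ x, edgeWeight Θ x * (∑ e, m e * centered Θ e (x e)) ^ 2
      = ∑ e, m e ^ 2 * (Θ e * (1 - Θ e)) := by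
  have h1 : ∀ x : Edges n, edgeWeight Θ x * (∑ e, m e * centered Θ e (x e)) ^ 2
      = ∑ e, ∑ e', m e * m e' *
        ((∏ l, edgeMass Θ l (x l)) * (centered Θ e (x e) * centered Θ e' (x e'))) := by
    intro x
    rw [sq, Finset.sum_mul_sum, Finset.mul_sum, edgeWeight_eq]
    refine Finset.sum_congr rfl fun e _ => ?_
    rw [Finset.mul_sum]
    exact Finset.sum_congr rfl fun e' _ => by ring
  simp_rw [h1]
  rw [Finset.sum_comm]
  refine Finset.sum_congr rfl fun e _ => ?_
  rw [Finset.sum_comm, Finset.sum_eq_single e]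
  · rw [← Finset.mul_sum, sum_prod_mul_apply (sum_edgeMass Θ) e
      fun b => centered Θ e b * centered Θ e b]
    simp [edgeMass, centered]
    ring
  · intro e' _ he
    rw [← Finset.mul_sum, sum_prod_mul_apply_mul_apply (sum_edgeMass Θ) he.symm
      (centered Θ e) (centered Θ e')]
    simp [edgeMass, centered]
    right; left; ring
  · simp

theorem sum_offDiag (f : Fin n → Fin n → ℝ) :
    ∑ p ∈ (Finset.univ : Finset (Fin n × Fin n)) with p.1 ≠ p.2, f p.1 p.2
      = ∑ e : NodePair n, (f e.1.1 e.1.2 + f e.1.2 e.1.1) := by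
  have h := two_mul_sum_nodePair (fun i j => f i j + f j i) fun i j => add_comm _ _
  have hswap : ∑ p ∈ (Finset.univ : Finset (Fin n × Fin n)) with p.1 ≠ p.2, f p.2 p.1
      = ∑ p ∈ (Finset.univ : Finset (Fin n × Fin n)) with p.1 ≠ p.2, f p.1 p.2 :=
    Finset.sum_nbij' Prod.swap Prod.swap (by simp [eq_comm]) (by simp [eq_comm]) (by simp)
      (by simp) fun p _ => rfl
  simp only [Finset.sum_add_distrib] at h ⊢
  rw [hswap] at h
  linarith

/-- The number of orientations of a pair of nodes that belong to a block. -/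
noncomputable def blockMult (z : Labels n k) (a b : Fin k) (e : NodePair n) : ℝ :=
  (if z e.1.1 = a ∧ z e.1.2 = b then 1 else 0) + if z e.1.2 = a ∧ z e.1.1 = b then 1 else 0

theorem sum_block_eq_sum_blockMult (z : Labels n k) (a b : Fin k) (f : Fin n → Fin n → ℝ)
    (hf : ∀ i j, f i j = f j i) :
    ∑ p ∈ block z a b, f p.1 p.2 = ∑ e, blockMult z a b e * f e.1.1 e.1.2 := by
  have h1 : block z a b = (Finset.univ.filter fun p : Fin n × Fin n => p.1 ≠ p.2).filter
      fun p => z p.1 = a ∧ z p.2 = b := by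
    ext p; simp only [mem_block, Finset.mem_filter, Finset.mem_univ, true_and]; tauto
  rw [h1, Finset.sum_filter,
    sum_offDiag fun i j => if z i = a ∧ z j = b then f i j else 0]
  refine Finset.sum_congr rfl fun e _ => ?_
  rw [blockMult, hf e.1.2 e.1.1, add_mul]
  simp

theorem blockMult_nonneg (z : Labels n k) (a b : Fin k) (e : NodePair n) :
    0 ≤ blockMult z a b e := by
  unfold blockMult; split_ifs <;> norm_num

theorem blockMult_le_two (z : Labels n k) (a b : Fin k) (e : NodePair n) :
    blockMult z a b e ≤ 2 := by
  unfold blockMult; split_ifs <;> norm_num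

theorem blockMult_mul_pairProb {Q : Matrix (Fin k) (Fin k) ℝ} (hQ : Q.IsSymm) (z : Labels n k)
    (a b : Fin k) (e : NodePair n) :
    blockMult z a b e * pairProb z Q e = blockMult z a b e * Q a b := by
  unfold blockMult pairProb
  split_ifs with h1 h2 h2
  · rw [h1.1, h1.2]
  · rw [h1.1, h1.2]
  · rw [h2.1, h2.2, hQ.apply]
  · simp

/-- The deviation of the number of edges in a block from its expectation. -/
noncomputable def blockDev (Q : Matrix (Fin k) (Fin k) ℝ) (z : Labels n k) (x : Edges n)
    (a b : Fin k) : ℝ :=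
  ∑ p ∈ block z a b, adjacency x p.1 p.2 - (block z a b).card * Q a b

/-- The factor `2` comes from diagonal blocks, in which each edge is counted in both orientations.
-/
theorem sum_edgeWeight_mul_blockDev_sq_le {Q : Matrix (Fin k) (Fin k) ℝ} (hQs : Q.IsSymm)
    (hQ : ∀ a b, 0 ≤ Q a b ∧ Q a b ≤ 1) (z : Labels n k) (a b : Fin k) :
    ∑ x, edgeWeight (pairProb z Q) x * blockDev Q z x a b ^ 2
      ≤ 2 * (block z a b).card * Q a b := by
  have hcard : ((block z a b).card : ℝ) = ∑ e, blockMult z a b e := by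
    have := sum_block_eq_sum_blockMult z a b (fun _ _ => 1) fun _ _ => rfl
    simpa using this
  have hdev : ∀ x, blockDev Q z x a b
      = ∑ e, blockMult z a b e * centered (pairProb z Q) e (x e) := by
    intro x
    rw [blockDev, sum_block_eq_sum_blockMult z a b _ (adjacency_symm x), hcard, Finset.sum_mul,
      ← Finset.sum_sub_distrib]
    refine Finset.sum_congr rfl fun e _ => ?_
    rw [centered, mul_sub, blockMult_mul_pairProb hQs, adjacency_pair]
  simp_rw [hdev]
  rw [sum_edgeWeight_mul_sq, hcard, Finset.mul_sum, Finset.sum_mul]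
  refine Finset.sum_le_sum fun e _ => ?_
  have h1 := blockMult_nonneg z a b e
  have h2 := blockMult_le_two z a b e
  have h3 := hQ (z e.1.1) (z e.1.2)
  calc blockMult z a b e ^ 2 * (pairProb z Q e * (1 - pairProb z Q e))
      = blockMult z a b e * (blockMult z a b e * pairProb z Q e * (1 - pairProb z Q e)) := by
        ring
    _ = blockMult z a b e * (blockMult z a b e * Q a b * (1 - pairProb z Q e)) := by
        rw [blockMult_mul_pairProb hQs]
    _ ≤ blockMult z a b e * (2 * Q a b * 1) := by
        refine mul_le_mul_of_nonneg_left (mul_le_mul (mul_le_mul_of_nonneg_right h2 (hQ a b).1)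
          ?_ ?_ (mul_nonneg zero_le_two (hQ a b).1)) h1
        · linarith [show pairProb z Q e = Q (z e.1.1) (z e.1.2) from rfl, h3.1]
        · linarith [show pairProb z Q e = Q (z e.1.1) (z e.1.2) from rfl, h3.2]
    _ = 2 * blockMult z a b e * Q a b := by ring

theorem le_card_block {δ : ℝ} {z : Labels n k} (hn : 2 ≤ δ * n)
    (hbal : IsBalanced δ z)
    (a b : Fin k) : δ ^ 2 * n ^ 2 / 2 ≤ (block z a b).card := by
  have h1 : community z a ×ˢ community z b
      ⊆ block z a b ∪ (community z a).image fun i => (i, i) := by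
    intro p hp
    rw [Finset.mem_product, mem_community, mem_community] at hp
    rw [Finset.mem_union, mem_block, Finset.mem_image]
    by_cases h : p.1 = p.2
    · exact Or.inr ⟨p.1, mem_community.2 hp.1, Prod.ext rfl h⟩
    · exact Or.inl ⟨hp.1, hp.2, h⟩
  have h2 := (Finset.card_le_card h1).trans (Finset.card_union_le _ _)
  rw [Finset.card_product] at h2
  have h3 := h2.trans (Nat.add_le_add_left Finset.card_image_le _)
  have h4 : ((community z a).card : ℝ) * (community z b).card
      ≤ (block z a b).card + (community z a).card := by exact_mod_cast h3
  have h5 := hbal a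
  have h6 := hbal b
  nlinarith [mul_le_mul h5 (show δ * n - 1 ≤ (community z b).card - 1 by linarith)
    (by linarith) (by linarith : (0 : ℝ) ≤ (community z a).card)]

end SecondMoment

/-! ### The empirical connection probabilities are inside `(0, 1)` -/

section EmpiricalInterior

variable {n k : ℕ} {Q : Matrix (Fin k) (Fin k) ℝ}

/-- Chebyshev's inequality: an empirical value `0` or `1` means that the edge count of the block
deviates from its mean by the full `card * Q a b` or `card * (1 - Q a b)`. -/
theorem edgesLaw_empiricalQ_notMem_le (hQ : Q ∈ connectionSpace k) {q c N : ℝ}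
    (hq : 0 < q) (hqQ : ∀ a b, q ≤ Q a b) (hc : c < 1) (hcQ : ∀ a b, Q a b ≤ c) (hN : 0 < N)
    {z : Labels n k} (hblock : ∀ a b, N ≤ (block z a b).card) :
    edgesLaw Q z {x | empiricalQ (adjacency x) z ∉ connectionSpace k}
      ≤ ENNReal.ofReal (k ^ 2 * (2 / (N * q) + 2 / (N * (1 - c) ^ 2))) := by
  have hQ1 : ∀ a b, 0 ≤ Q a b ∧ Q a b ≤ 1 := fun a b => ⟨(hQ.2 a b).1.le, (hQ.2 a b).2.le⟩
  have hcard : ∀ a b, (0 : ℝ) < (block z a b).card := fun a b => hN.trans_le (hblock a b)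
  set g : Fin k → Fin k → ℝ := fun a b => 1 / ((block z a b).card * Q a b) ^ 2
    + 1 / ((block z a b).card * (1 - Q a b)) ^ 2 with hg
  have hg0 : ∀ a b, 0 ≤ g a b := fun a b => by positivity
  refine (edgesLaw_le hQ1 z (f := fun x => ∑ a, ∑ b, g a b * blockDev Q z x a b ^ 2)
    (fun x => Finset.sum_nonneg fun a _ => Finset.sum_nonneg fun b _ =>
      mul_nonneg (hg0 a b) (sq_nonneg _)) ?_).trans (ENNReal.ofReal_le_ofReal ?_)
  · intro x hx
    have h1 : ∃ a b, ¬ (0 < empiricalQ (adjacency x) z a b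
        ∧ empiricalQ (adjacency x) z a b < 1) := by
      by_contra! h
      exact hx ⟨empiricalQ_isSymm x z, h⟩
    obtain ⟨a, b, hab⟩ := h1
    have hle : g a b * blockDev Q z x a b ^ 2 ≤ ∑ a, ∑ b, g a b * blockDev Q z x a b ^ 2 :=
      (Finset.single_le_sum (f := fun b => g a b * blockDev Q z x a b ^ 2)
        (fun b _ => mul_nonneg (hg0 a b) (sq_nonneg _)) (Finset.mem_univ b)).trans
      (Finset.single_le_sum (f := fun a => ∑ b, g a b * blockDev Q z x a b ^ 2)
        (fun a _ => Finset.sum_nonneg fun b _ => mul_nonneg (hg0 a b) (sq_nonneg _))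
        (Finset.mem_univ a))
    refine le_trans ?_ hle
    have hQp := (hQ.2 a b).1
    have hQm := sub_pos.2 (hQ.2 a b).2
    have hNp := hcard a b
    have hMN := sum_adjacency_le_card x (block z a b)
    have hM := sum_adjacency_nonneg x (block z a b)
    rcases hM.eq_or_lt with h0 | h0
    · have : blockDev Q z x a b ^ 2 = ((block z a b).card * Q a b) ^ 2 := by
        rw [blockDev, ← h0]; ring
      rw [this, hg]
      have h3 : 1 / (((block z a b).card : ℝ) * Q a b) ^ 2
          * ((block z a b).card * Q a b) ^ 2 = 1 := by field_simp
      have h4 : 0 ≤ 1 / (((block z a b).card : ℝ) * (1 - Q a b)) ^ 2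
          * ((block z a b).card * Q a b) ^ 2 := by positivity
      simp only [add_mul]
      linarith
    · have h2 : ∑ p ∈ block z a b, adjacency x p.1 p.2 = (block z a b).card := by
        refine le_antisymm hMN ?_
        by_contra! h
        exact hab ⟨div_pos h0 hNp, (div_lt_one hNp).2 h⟩
      have : blockDev Q z x a b ^ 2 = ((block z a b).card * (1 - Q a b)) ^ 2 := by
        rw [blockDev, h2]; ring
      rw [this, hg]
      have h3 : 1 / (((block z a b).card : ℝ) * (1 - Q a b)) ^ 2
          * ((block z a b).card * (1 - Q a b)) ^ 2 = 1 := by field_simp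
      have h4 : 0 ≤ 1 / (((block z a b).card : ℝ) * Q a b) ^ 2
          * ((block z a b).card * (1 - Q a b)) ^ 2 := by positivity
      simp only [add_mul]
      linarith
  · have h1 : ∑ x, edgeWeight (pairProb z Q) x * ∑ a, ∑ b, g a b * blockDev Q z x a b ^ 2
        = ∑ a, ∑ b, g a b * ∑ x, edgeWeight (pairProb z Q) x * blockDev Q z x a b ^ 2 := by
      simp_rw [Finset.mul_sum]
      rw [Finset.sum_comm]
      refine Finset.sum_congr rfl fun a _ => ?_
      rw [Finset.sum_comm]
      exact Finset.sum_congr rfl fun b _ => Finset.sum_congr rfl fun x _ => by ring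
    rw [h1]
    calc _ ≤ ∑ _a : Fin k, ∑ _b : Fin k, (2 / (N * q) + 2 / (N * (1 - c) ^ 2)) := by
          refine Finset.sum_le_sum fun a _ => Finset.sum_le_sum fun b _ => ?_
          have hQp := (hQ.2 a b).1
          have hQm := sub_pos.2 (hQ.2 a b).2
          have hNp := hcard a b
          refine (mul_le_mul_of_nonneg_left (sum_edgeWeight_mul_blockDev_sq_le hQ.1 hQ1 z a b)
            (hg0 a b)).trans ?_
          have h2 : g a b * (2 * (block z a b).card * Q a b)
              = 2 / ((block z a b).card * Q a b)
                + 2 * Q a b / ((block z a b).card * (1 - Q a b) ^ 2) := by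
            simp only [hg]; field_simp
          rw [h2]
          have h1c : 0 < 1 - c := by linarith
          refine add_le_add ?_ ?_
          · exact div_le_div_of_nonneg_left zero_le_two (mul_pos hN hq)
              (mul_le_mul (hblock a b) (hqQ a b) hq.le hNp.le)
          · refine div_le_div₀ zero_le_two (by linarith) (by positivity)
              (mul_le_mul (hblock a b) ?_ (by positivity) hNp.le)
            exact pow_le_pow_left₀ h1c.le (by linarith [hcQ a b]) 2
      _ = _ := by simp; ring

/-- The squared Frobenius error of the estimator with the true labels. -/
theorem frobeniusSq_theta_sub_thetaHat (x : Edges n) (z : Labels n k) :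
    frobeniusSq (theta z Q - thetaHat (adjacency x) z)
      = ∑ a, ∑ b, blockDev Q z x a b ^ 2 / (block z a b).card := by
  have h1 : frobeniusSq (theta z Q - thetaHat (adjacency x) z)
      = ∑ p ∈ (Finset.univ : Finset (Fin n × Fin n)) with p.1 ≠ p.2,
        (Q (z p.1) (z p.2) - empiricalQ (adjacency x) z (z p.1) (z p.2)) ^ 2 := by
    rw [frobeniusSq, Finset.sum_filter, ← Finset.univ_product_univ, Finset.sum_product]
    refine Finset.sum_congr rfl fun i _ => Finset.sum_congr rfl fun j _ => ?_
    by_cases h : i = j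
    · simp [h, theta, thetaHat]
    · simp [h, theta, thetaHat]
  rw [h1, ← sum_block z]
  refine Finset.sum_congr rfl fun a _ => Finset.sum_congr rfl fun b _ => ?_
  have h2 : ∀ p ∈ block z a b,
      (Q (z p.1) (z p.2) - empiricalQ (adjacency x) z (z p.1) (z p.2)) ^ 2
        = (Q a b - empiricalQ (adjacency x) z a b) ^ 2 := fun p hp => by
    rw [mem_block] at hp
    rw [hp.1, hp.2.1]
  rw [Finset.sum_congr rfl h2, Finset.sum_const, nsmul_eq_mul, empiricalQ, blockDev]
  rcases eq_or_ne ((block z a b).card : ℝ) 0 with h | h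
  · simp [h]
  · field_simp
    ring

/-- Each block contributes its variance divided by its size to the expected error, so the block
sizes cancel and no balance of `z` is required. -/
theorem edgesLaw_lt_frobeniusSq_le (hQ : Q ∈ connectionSpace k) {q r : ℝ}
    (hqQ : ∀ a b, Q a b ≤ q) (hr : 0 < r) (z : Labels n k) :
    edgesLaw Q z {x | r < frobeniusSq (theta z Q - thetaHat (adjacency x) z)}
      ≤ ENNReal.ofReal (2 * k ^ 2 * q / r) := by
  have hQ1 : ∀ a b, 0 ≤ Q a b ∧ Q a b ≤ 1 := fun a b => ⟨(hQ.2 a b).1.le, (hQ.2 a b).2.le⟩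
  refine (edgesLaw_le hQ1 z
    (f := fun x => frobeniusSq (theta z Q - thetaHat (adjacency x) z) / r)
    (fun x => ?_) ?_).trans (ENNReal.ofReal_le_ofReal ?_)
  · exact div_nonneg (Finset.sum_nonneg fun i _ => Finset.sum_nonneg fun j _ => sq_nonneg _) hr.le
  · exact fun x hx => (one_le_div hr).2 (le_of_lt hx)
  · simp_rw [frobeniusSq_theta_sub_thetaHat, ← mul_div_assoc]
    rw [← Finset.sum_div]
    refine div_le_div_of_nonneg_right ?_ hr.le
    have h1 : ∑ x, edgeWeight (pairProb z Q) x
          * ∑ a, ∑ b, blockDev Q z x a b ^ 2 / (block z a b).card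
        = ∑ a, ∑ b, (∑ x, edgeWeight (pairProb z Q) x * blockDev Q z x a b ^ 2)
          / (block z a b).card := by
      simp_rw [Finset.mul_sum, Finset.sum_div]
      rw [Finset.sum_comm]
      refine Finset.sum_congr rfl fun a _ => ?_
      rw [Finset.sum_comm]
      exact Finset.sum_congr rfl fun b _ => Finset.sum_congr rfl fun x _ => by ring
    rw [h1]
    calc _ ≤ ∑ _a : Fin k, ∑ _b : Fin k, 2 * q := by
          refine Finset.sum_le_sum fun a _ => Finset.sum_le_sum fun b _ => ?_
          refine (div_le_div_of_nonneg_right (sum_edgeWeight_mul_blockDev_sq_le hQ.1 hQ1 z a b)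
            (Nat.cast_nonneg _)).trans ?_
          rcases (Nat.cast_nonneg (α := ℝ) (block z a b).card).eq_or_lt with h | h
          · rw [← h]
            have := (hQ1 a b).1.trans (hqQ a b)
            simpa using this
          · rw [div_le_iff₀ h]
            nlinarith [hqQ a b]
      _ = _ := by simp; ring

end EmpiricalInterior

/-! ### Bhattacharyya bounds -/

section Bhattacharyya

variable {n k : ℕ}

/-- The second root is bounded by the arithmetic mean and only the first one keeps its exact form.
This loses nothing essential for sparse networks, where the differences sit in the probabilities of
edges. -/
theorem sqrt_mul_add_sqrt_mul_le {a b : ℝ} (ha : 0 ≤ a) (ha1 : a ≤ 1) (hb : 0 ≤ b)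
    (hb1 : b ≤ 1) :
    √(a * b) + √((1 - a) * (1 - b)) ≤ Real.exp (-(1 / 2) * (√a - √b) ^ 2) := by
  have h1 : √((1 - a) * (1 - b)) ≤ 1 - (a + b) / 2 :=
    Real.sqrt_le_iff.2 ⟨by linarith, by nlinarith [sq_nonneg (a - b)]⟩
  have h2 : (√a - √b) ^ 2 = a + b - 2 * √(a * b) := by
    rw [Real.sqrt_mul ha, sub_sq, Real.sq_sqrt ha, Real.sq_sqrt hb]; ring
  have h3 := Real.add_one_le_exp (-(1 / 2) * (√a - √b) ^ 2)
  rw [h2] at h3 ⊢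
  linarith

theorem edgeMass_nonneg {Θ : NodePair n → ℝ} (hΘ : ∀ e, 0 ≤ Θ e ∧ Θ e ≤ 1) (e : NodePair n)
    (b : Bool) : 0 ≤ edgeMass Θ e b := by
  unfold edgeMass
  split_ifs
  · exact (hΘ e).1
  · exact sub_nonneg.2 (hΘ e).2

theorem sum_sqrt_edgeWeight_mul_le {Θ Θ' : NodePair n → ℝ} (hΘ : ∀ e, 0 ≤ Θ e ∧ Θ e ≤ 1)
    (hΘ' : ∀ e, 0 ≤ Θ' e ∧ Θ' e ≤ 1) :
    ∑ x, √(edgeWeight Θ x * edgeWeight Θ' x)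
      ≤ Real.exp (-(1 / 2) * ∑ e, (√(Θ e) - √(Θ' e)) ^ 2) := by
  have h1 : ∀ x : Edges n, √(edgeWeight Θ x * edgeWeight Θ' x)
      = ∏ e, √(edgeMass Θ e (x e) * edgeMass Θ' e (x e)) := fun x => by
    rw [edgeWeight_eq, edgeWeight_eq, ← Finset.prod_mul_distrib, Real.sqrt_prod]
    exact fun e _ => mul_nonneg (edgeMass_nonneg hΘ _ _) (edgeMass_nonneg hΘ' _ _)
  simp_rw [h1]
  rw [sum_prod_apply (fun e b => √(edgeMass Θ e b * edgeMass Θ' e b)), Finset.mul_sum,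
    Real.exp_sum]
  refine Finset.prod_le_prod (fun e _ => Finset.sum_nonneg fun b _ => Real.sqrt_nonneg _)
    fun e _ => ?_
  rw [Fintype.sum_bool]
  exact sqrt_mul_add_sqrt_mul_le (hΘ e).1 (hΘ e).2 (hΘ' e).1 (hΘ' e).2

/-- The weight factorizes over nodes: at each node one label costs `1` and the others cost `w`. -/
theorem sum_pow_hammingDist_le {w : ℝ} (hw : 0 ≤ w) (z' : Labels n k) :
    ∑ z : Labels n k, w ^ hammingDist z z' ≤ (1 + k * w) ^ n := by
  have h1 : ∀ z : Labels n k, w ^ hammingDist z z'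
      = ∏ i, if z i ≠ z' i then w else 1 := fun z => by
    rw [hammingDist, ← Finset.prod_const, Finset.prod_filter]
  simp_rw [h1]
  rw [sum_prod_apply (fun i b => if b ≠ z' i then w else 1)]
  calc _ ≤ ∏ _i : Fin n, (1 + k * w) := by
        refine Finset.prod_le_prod (fun i _ => Finset.sum_nonneg fun b _ => by
          split_ifs <;> [exact hw; exact zero_le_one]) fun i _ => ?_
        rw [← Finset.add_sum_erase _ _ (Finset.mem_univ (z' i))]
        have h2 : ∑ b ∈ Finset.univ.erase (z' i), (if b ≠ z' i then w else 1)
            ≤ ∑ _b : Fin k, w := by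
          refine le_trans (Finset.sum_le_sum fun b hb => ?_)
            (Finset.sum_le_sum_of_subset_of_nonneg (Finset.subset_univ _) fun _ _ _ => hw)
          rw [if_pos (Finset.ne_of_mem_erase hb)]
        rw [Finset.sum_const, Finset.card_univ, Fintype.card_fin, nsmul_eq_mul] at h2
        rw [if_neg (not_not.2 rfl)]
        linarith
    _ = _ := by simp

/-- The label functions that are not equal to `z₀` up to a permutation of the labels. -/
noncomputable def inequivalent (z₀ : Labels n k) : Finset (Labels n k) := by
  classical exact {z | ∀ σ : Equiv.Perm (Fin k), z ≠ σ ∘ z₀}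

theorem mem_inequivalent {z₀ z : Labels n k} :
    z ∈ inequivalent z₀ ↔ ∀ σ : Equiv.Perm (Fin k), z ≠ σ ∘ z₀ := by
  classical
  unfold inequivalent
  rw [Finset.mem_filter]
  exact ⟨fun h => h.2, fun h => ⟨Finset.mem_univ _, h⟩⟩

theorem sum_inequivalent_le {w : ℝ} (hw : 0 ≤ w) (z₀ : Labels n k)
    (σ : Labels n k → Equiv.Perm (Fin k)) :
    ∑ z ∈ inequivalent z₀, w ^ hammingDist z (σ z ∘ z₀)
      ≤ k.factorial * ((1 + k * w) ^ n - 1) := by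
  classical
  calc _ ≤ ∑ z ∈ inequivalent z₀, ∑ τ : Equiv.Perm (Fin k), w ^ hammingDist z (τ ∘ z₀) :=
        Finset.sum_le_sum fun z _ => Finset.single_le_sum
          (f := fun τ : Equiv.Perm (Fin k) => w ^ hammingDist z (τ ∘ z₀))
          (fun τ _ => pow_nonneg hw _) (Finset.mem_univ (σ z))
    _ = ∑ τ : Equiv.Perm (Fin k), ∑ z ∈ inequivalent z₀, w ^ hammingDist z (τ ∘ z₀) :=
        Finset.sum_comm
    _ ≤ ∑ _τ : Equiv.Perm (Fin k), ((1 + k * w) ^ n - 1) := by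
        refine Finset.sum_le_sum fun τ _ => ?_
        have h1 : ∑ z ∈ inequivalent z₀, w ^ hammingDist z (τ ∘ z₀)
            ≤ ∑ z ∈ Finset.univ.erase (τ ∘ z₀), w ^ hammingDist z (τ ∘ z₀) :=
          Finset.sum_le_sum_of_subset_of_nonneg
            (fun z hz => Finset.mem_erase.2 ⟨mem_inequivalent.1 hz τ, Finset.mem_univ _⟩)
            fun _ _ _ => pow_nonneg hw _
        have h2 := Finset.add_sum_erase Finset.univ
          (fun z : Labels n k => w ^ hammingDist z (τ ∘ z₀)) (Finset.mem_univ (τ ∘ z₀))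
        simp only [hammingDist_self, pow_zero] at h2
        linarith [sum_pow_hammingDist_le hw (τ ∘ z₀)]
    _ = _ := by
        rw [Finset.sum_const, Finset.card_univ, Fintype.card_perm, Fintype.card_fin, nsmul_eq_mul]

theorem logLik_empiricalQ_perm_comp (A : Matrix (Fin n) (Fin n) ℝ) (z : Labels n k)
    (σ : Equiv.Perm (Fin k)) :
    logLik A (σ ∘ z) (empiricalQ A (σ ∘ z)) = logLik A z (empiricalQ A z) := by
  simp only [logLik, Function.comp_apply, empiricalQ_perm_comp]

theorem edgeWeight_pos {Q : Matrix (Fin k) (Fin k) ℝ} (hQ : Q ∈ connectionSpace k)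
    (z : Labels n k) (x : Edges n) : 0 < edgeWeight (pairProb z Q) x := by
  refine Finset.prod_pos fun e _ => ?_
  split_ifs
  · exact (hQ.2 _ _).1
  · exact sub_pos.2 (hQ.2 _ _).2

/-- Given the true labels, the likelihood has a gap with high probability. -/
theorem edgesLaw_not_hasLikelihoodGap_le {Q : Matrix (Fin k) (Fin k) ℝ}
    (hQ : Q ∈ connectionSpace k) {γ δ : ℝ} (hγ : 0 < γ) (hδ : 0 < δ) (hδ1 : δ ≤ 1)
    (hs : ∀ a b, a ≠ b → ∃ c, γ ≤ (√(Q a c) - √(Q b c)) ^ 2) (hn : 4 ≤ δ * n)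
    {z₀ : Labels n k} (hbal : IsBalanced δ z₀) {κ : ℝ} (hκ : κ = γ * δ ^ 2 / 32 * n) :
    edgesLaw Q z₀ {x | ¬ HasLikelihoodGap (adjacency x) z₀ κ}
      ≤ ENNReal.ofReal ((empiricalGrid n k).card
        * (k.factorial * ((1 + k * Real.exp (-κ / 2)) ^ n - 1))) := by
  have hQ1 : ∀ a b, 0 ≤ Q a b ∧ Q a b ≤ 1 := fun a b => ⟨(hQ.2 a b).1.le, (hQ.2 a b).2.le⟩
  have hW := edgeWeight_pos hQ z₀
  -- Identifiability is applied to entrywise square roots, since these enter the Bhattacharyya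
  -- bound.
  choose σ hσ using fun (z : Labels n k) (Q' : Matrix (Fin k) (Fin k) ℝ) =>
    exists_perm_hammingDist_le (S := Matrix.of fun a b => √(Q' a b))
      (s := Matrix.of fun a b => √(Q a b)) z hγ hδ hδ1 hs hn hbal
  set d : Labels n k → Matrix (Fin k) (Fin k) ℝ → ℕ :=
    fun z Q' => hammingDist z (σ z Q' ∘ z₀) with hd
  set f : Edges n → ℝ := fun x => ∑ Q' ∈ empiricalGrid n k, ∑ z ∈ inequivalent z₀,
    Real.exp (κ * d z Q' / 2) *
      (√(edgeWeight (pairProb z Q') x * edgeWeight (pairProb z₀ Q) x)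
        / edgeWeight (pairProb z₀ Q) x) with hf
  have hterm : ∀ x Q' z, 0 ≤ Real.exp (κ * d z Q' / 2) *
      (√(edgeWeight (pairProb z Q') x * edgeWeight (pairProb z₀ Q) x)
        / edgeWeight (pairProb z₀ Q) x) := fun x Q' z =>
    mul_nonneg (Real.exp_pos _).le (div_nonneg (Real.sqrt_nonneg _) (hW x).le)
  refine (edgesLaw_le hQ1 z₀ (f := f) (fun x => Finset.sum_nonneg fun Q' _ =>
    Finset.sum_nonneg fun z _ => hterm x Q' z) ?_).trans (ENNReal.ofReal_le_ofReal ?_)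
  · intro x hx
    simp only [Set.mem_ofPred_eq, HasLikelihoodGap] at hx
    push Not at hx
    obtain ⟨Q₁, hQ₁, z, hz⟩ := hx
    -- A permutation of `z₀` cannot violate the gap, because its profile likelihood equals that of
    -- `z₀`.
    have hz_mem : z ∈ inequivalent z₀ := by
      rw [mem_inequivalent]
      rintro τ rfl
      have h1 := hz τ
      rw [hammingDist_self, Nat.cast_zero, mul_zero, sub_zero,
        ← logLik_empiricalQ_perm_comp _ _ τ] at h1
      exact absurd (logLik_le_logLik_empiricalQ hQ₁) (not_le.2 h1)
    -- Passing to the empirical matrix preserves the violation and leaves finitely many candidates.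
    set Q' := empiricalQ (adjacency x) z with hQ'
    have h1 : logLik (adjacency x) z₀ Q - κ * d z Q' ≤ logLik (adjacency x) z Q' := by
      have h2 := hz (σ z Q')
      have h3 := logLik_le_logLik_empiricalQ (x := x) (z := z) hQ₁
      have h4 := logLik_le_logLik_empiricalQ (x := x) (z := z₀) hQ
      linarith
    have h2 : Real.exp (-(κ * d z Q')) * edgeWeight (pairProb z₀ Q) x
        ≤ edgeWeight (pairProb z Q') x := by
      rw [← exp_logLik_of_mem_connectionSpace hQ, ← exp_logLik_empiricalQ, ← Real.exp_add]
      exact Real.exp_le_exp.2 (by linarith)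
    have h3 : 1 ≤ Real.exp (κ * d z Q' / 2) *
        (√(edgeWeight (pairProb z Q') x * edgeWeight (pairProb z₀ Q) x)
          / edgeWeight (pairProb z₀ Q) x) := by
      have h4 : Real.exp (-(κ * d z Q' / 2)) * edgeWeight (pairProb z₀ Q) x
          ≤ √(edgeWeight (pairProb z Q') x * edgeWeight (pairProb z₀ Q) x) := by
        refine Real.le_sqrt_of_sq_le ?_
        calc (Real.exp (-(κ * d z Q' / 2)) * edgeWeight (pairProb z₀ Q) x) ^ 2
            = (Real.exp (-(κ * d z Q')) * edgeWeight (pairProb z₀ Q) x)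
              * edgeWeight (pairProb z₀ Q) x := by
              rw [mul_pow, ← Real.exp_nat_mul, sq (edgeWeight _ _)]
              push_cast
              rw [show (2 : ℝ) * -(κ * d z Q' / 2) = -(κ * d z Q') by ring]
              ring
          _ ≤ _ := mul_le_mul_of_nonneg_right h2 (hW x).le
      rw [← le_div_iff₀ (hW x)] at h4
      calc (1 : ℝ) = Real.exp (κ * d z Q' / 2) * Real.exp (-(κ * d z Q' / 2)) := by
            rw [← Real.exp_add, add_neg_cancel, Real.exp_zero]
        _ ≤ _ := mul_le_mul_of_nonneg_left h4 (Real.exp_pos _).le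
    refine h3.trans ((Finset.single_le_sum (fun z _ => hterm x Q' z) hz_mem).trans ?_)
    exact Finset.single_le_sum (f := fun Q' => ∑ z ∈ inequivalent z₀,
      Real.exp (κ * d z Q' / 2) *
        (√(edgeWeight (pairProb z Q') x * edgeWeight (pairProb z₀ Q) x)
          / edgeWeight (pairProb z₀ Q) x))
      (fun Q' _ => Finset.sum_nonneg fun z _ => hterm x Q' z) (empiricalQ_mem_empiricalGrid x z)
  · have h1 : ∑ x, edgeWeight (pairProb z₀ Q) x * f x
        = ∑ Q' ∈ empiricalGrid n k, ∑ z ∈ inequivalent z₀, Real.exp (κ * d z Q' / 2)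
          * ∑ x, √(edgeWeight (pairProb z Q') x * edgeWeight (pairProb z₀ Q) x) := by
      simp_rw [hf, Finset.mul_sum]
      rw [Finset.sum_comm]
      refine Finset.sum_congr rfl fun Q' _ => ?_
      rw [Finset.sum_comm]
      refine Finset.sum_congr rfl fun z _ => Finset.sum_congr rfl fun x _ => ?_
      have := (hW x).ne'
      field_simp
    rw [h1]
    calc _ ≤ ∑ Q' ∈ empiricalGrid n k, ∑ z ∈ inequivalent z₀,
            Real.exp (-κ / 2) ^ hammingDist z (σ z Q' ∘ z₀) := by
          refine Finset.sum_le_sum fun Q' hQ' => Finset.sum_le_sum fun z _ => ?_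
          have hsymm := isSymm_of_mem_empiricalGrid hQ'
          have h2 := hσ z Q'
          rw [sum_rowDistSq _ _ _ _
            (Matrix.IsSymm.ext fun a b => by simp [hsymm.apply a b])
            (Matrix.IsSymm.ext fun a b => by simp [hQ.1.apply a b])] at h2
          have h3 := sum_sqrt_edgeWeight_mul_le (Θ := pairProb z Q') (Θ' := pairProb z₀ Q)
            (fun e => bounds_of_mem_empiricalGrid hQ' _ _) (fun e => hQ1 _ _)
          calc _ ≤ Real.exp (κ * d z Q' / 2) * Real.exp (-(1 / 2) *
                  ∑ e, (√(pairProb z Q' e) - √(pairProb z₀ Q e)) ^ 2) :=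
                mul_le_mul_of_nonneg_left h3 (Real.exp_pos _).le
            _ ≤ Real.exp (κ * d z Q' / 2) * Real.exp (-(κ * d z Q')) := by
                refine mul_le_mul_of_nonneg_left (Real.exp_le_exp.2 ?_) (Real.exp_pos _).le
                -- The `32` in `κ` is the `8` of `exists_perm_hammingDist_le` times `4`. The
                -- affinity is then at most `exp (-κ d)`, so half of the exponent survives the
                -- factor `exp (κ d / 2)` from Markov's inequality.
                have h4 : 4 * (κ * d z Q')
                    ≤ 2 * ∑ e, (√(pairProb z Q' e) - √(pairProb z₀ Q e)) ^ 2 := by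
                  calc _ = γ * δ ^ 2 / 8 * n * (hammingDist z (σ z Q' ∘ z₀) : ℝ) := by
                        rw [hκ, hd]; ring
                    _ ≤ _ := h2
                linarith
            _ = _ := by
                rw [← Real.exp_add, ← Real.exp_nat_mul]
                congr 1
                ring
      _ ≤ ∑ Q' ∈ empiricalGrid n k, k.factorial * ((1 + k * Real.exp (-κ / 2)) ^ n - 1) :=
          Finset.sum_le_sum fun Q' _ =>
            sum_inequivalent_le (Real.exp_pos _).le z₀ fun z => σ z Q'
      _ = _ := by rw [Finset.sum_const, nsmul_eq_mul]

theorem one_add_pow_sub_one_le {t : ℝ} (ht : 0 ≤ t) (hn : n * t ≤ 1) :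
    (1 + t) ^ n - 1 ≤ 2 * (n * t) := by
  have h0 : 0 ≤ n * t := by positivity
  have h1 : (1 + t) ^ n ≤ Real.exp (n * t) := by
    rw [Real.exp_nat_mul]
    exact pow_le_pow_left₀ (by linarith) (by linarith [Real.add_one_le_exp t]) n
  have h2 := Real.abs_exp_sub_one_le (x := n * t) (by rwa [abs_of_nonneg h0])
  rw [abs_of_nonneg h0] at h2
  linarith [le_abs_self (Real.exp (n * t) - 1)]

/-- Of the decay `n ^ (-(4 * k ^ 2 + 2))`, the power `4 * k ^ 2` pays for the grid and one more for
the choice of a misclassified node; `1 / n` remains. -/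
theorem grid_union_bound_le (hk : 0 < k) (hkn : k ≤ n) {κ : ℝ}
    (hκ : (4 * k ^ 2 + 2) * Real.log n ≤ κ / 2) :
    (empiricalGrid n k).card * (k.factorial * ((1 + k * Real.exp (-κ / 2)) ^ n - 1))
      ≤ 2 ^ (2 * k ^ 2) * k.factorial * (2 * k) / n := by
  have hn : (1 : ℝ) ≤ n := by exact_mod_cast hk.trans_le hkn
  have hn0 : (0 : ℝ) < n := by linarith
  have hw : Real.exp (-κ / 2) ≤ 1 / (n : ℝ) ^ (4 * k ^ 2 + 2) := by
    have h1 : Real.exp (-κ / 2) ≤ Real.exp (-(((4 * k ^ 2 + 2 : ℕ) : ℝ) * Real.log n)) := by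
      apply Real.exp_le_exp.2
      push_cast
      linarith
    rwa [Real.exp_neg, Real.exp_nat_mul, Real.exp_log hn0, ← one_div] at h1
  have hw2 : n * (k * Real.exp (-κ / 2)) ≤ 1 := by
    have h1 : 1 / (n : ℝ) ^ (4 * k ^ 2 + 2) ≤ 1 / (n : ℝ) ^ 2 :=
      one_div_le_one_div_of_le (by positivity) (pow_le_pow_right₀ hn (by omega))
    calc n * (k * Real.exp (-κ / 2)) ≤ n * (n * (1 / (n : ℝ) ^ 2)) := by
          refine mul_le_mul_of_nonneg_left (mul_le_mul (by exact_mod_cast hkn) (hw.trans h1)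
            (Real.exp_pos _).le hn0.le) hn0.le
      _ = 1 := by field_simp
  have hpow := one_add_pow_sub_one_le (n := n) (t := k * Real.exp (-κ / 2)) (by positivity) hw2
  have hgrid : ((empiricalGrid n k).card : ℝ) ≤ (2 * (n : ℝ) ^ 2) ^ (2 * k ^ 2) := by
    calc ((empiricalGrid n k).card : ℝ) ≤ ((n : ℝ) ^ 2 + 1) ^ (2 * k ^ 2) := by
          exact_mod_cast card_empiricalGrid_le n k
      _ ≤ _ := pow_le_pow_left₀ (by positivity) (by nlinarith) _
  have h0 : (0 : ℝ) ≤ (1 + k * Real.exp (-κ / 2)) ^ n - 1 :=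
    sub_nonneg.2 (one_le_pow₀ (by
      have := mul_nonneg (Nat.cast_nonneg (α := ℝ) k) (Real.exp_pos (-κ / 2)).le
      linarith))
  calc _ ≤ (2 * (n : ℝ) ^ 2) ^ (2 * k ^ 2) * (k.factorial
          * (2 * (n * (k * (1 / (n : ℝ) ^ (4 * k ^ 2 + 2)))))) := by
        refine mul_le_mul hgrid (mul_le_mul_of_nonneg_left (hpow.trans ?_) (by positivity))
          (mul_nonneg (by positivity) h0) (by positivity)
        gcongr
    _ = _ := by
        rw [mul_pow, ← pow_mul, show 2 * (2 * k ^ 2) = 4 * k ^ 2 by ring, pow_add]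
        field_simp

end Bhattacharyya

/-! ### The true labels are balanced -/

section Balanced

variable {n k : ℕ}

theorem exp_neg_card_community (z : Labels n k) (a : Fin k) :
    Real.exp (-((community z a).card : ℝ)) = ∏ i, if z i = a then Real.exp (-1) else 1 := by
  rw [← Finset.prod_filter, Finset.prod_const, ← Real.exp_nat_mul]
  simp [community]

/-- Chernoff bound for the lower tail of each community size, with exponential parameter `-1`, and a
union bound over communities. -/
theorem labelsLaw_not_isBalanced_le {α : Fin k → ℝ} (hα : α ∈ stdSimplex ℝ (Fin k)) {δ : ℝ}
    (hδ : ∀ a, 2 * δ ≤ α a) :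
    labelsLaw n α {z | IsBalanced δ z}ᶜ ≤ ENNReal.ofReal (k * Real.exp (-(δ / 5 * n))) := by
  refine (labelsLaw_le hα (f := fun z => ∑ a,
    Real.exp (α a / 2 * n) * Real.exp (-((community z a).card : ℝ)))
    (fun z => Finset.sum_nonneg fun a _ => by positivity) ?_).trans (ENNReal.ofReal_le_ofReal ?_)
  · intro z hz
    simp only [IsBalanced, Set.mem_compl_iff, Set.mem_ofPred_eq, not_forall, not_le] at hz
    obtain ⟨a, ha⟩ := hz
    refine le_trans ?_ (Finset.single_le_sum (f := fun a => Real.exp (α a / 2 * n) *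
      Real.exp (-((community z a).card : ℝ))) (fun a _ => by positivity) (Finset.mem_univ a))
    rw [← Real.exp_add]
    refine Real.one_le_exp ?_
    have := mul_le_mul_of_nonneg_right (hδ a) (Nat.cast_nonneg (α := ℝ) n)
    linarith
  · simp_rw [Finset.mul_sum]
    rw [Finset.sum_comm]
    calc _ ≤ ∑ _a : Fin k, Real.exp (-(δ / 5 * n)) := by
          refine Finset.sum_le_sum fun a _ => ?_
          have h1 : ∀ z : Labels n k, (∏ i, α (z i)) * (Real.exp (α a / 2 * n)
              * Real.exp (-((community z a).card : ℝ)))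
              = Real.exp (α a / 2 * n)
                * ∏ i, (α (z i) * if z i = a then Real.exp (-1) else 1) := fun z => by
            rw [exp_neg_card_community, Finset.prod_mul_distrib]; ring
          simp_rw [h1]
          rw [← Finset.mul_sum, sum_prod_apply (ι := Fin n)
            (fun _ b => α b * if b = a then Real.exp (-1) else 1), Finset.prod_const,
            Finset.card_univ, Fintype.card_fin]
          have h2 : ∑ b, (α b * if b = a then Real.exp (-1) else 1)
              ≤ Real.exp (-(α a * (1 - Real.exp (-1)))) := by
            have h3 : ∀ b, (α b * if b = a then Real.exp (-1) else 1)
                = α b - if b = a then α a * (1 - Real.exp (-1)) else 0 := fun b => by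
              split_ifs with h
              · rw [h]; ring
              · ring
            simp_rw [h3]
            rw [Finset.sum_sub_distrib, hα.2]
            simp only [Finset.sum_ite_eq', Finset.mem_univ, if_true]
            linarith [Real.add_one_le_exp (-(α a * (1 - Real.exp (-1))))]
          have h4 : (0 : ℝ) ≤ ∑ b, (α b * if b = a then Real.exp (-1) else 1) :=
            Finset.sum_nonneg fun b _ => mul_nonneg (hα.1 b) (by split_ifs <;> positivity)
          calc _ ≤ Real.exp (α a / 2 * n) * Real.exp (-(α a * (1 - Real.exp (-1)))) ^ n :=
                mul_le_mul_of_nonneg_left (pow_le_pow_left₀ h4 h2 n) (Real.exp_pos _).le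
            _ ≤ _ := by
                rw [← Real.exp_nat_mul, ← Real.exp_add]
                refine Real.exp_le_exp.2 ?_
                -- The exponent is then at most `(1/2 - 0.6) * α a * n`, which is at most `-(δ / 5)
                -- * n` since `2 * δ ≤ α a`.
                have h5 : Real.exp (-1) ≤ 0.4 := by
                  rw [Real.exp_neg, inv_le_comm₀ (Real.exp_pos _) (by norm_num)]
                  linarith [Real.exp_one_gt_d9]
                have h6 : 0 ≤ α a * n * (0.4 - Real.exp (-1)) :=
                  mul_nonneg (mul_nonneg (hα.1 a) (Nat.cast_nonneg _)) (by linarith)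
                have h7 := mul_le_mul_of_nonneg_right (hδ a) (Nat.cast_nonneg (α := ℝ) n)
                nlinarith
      _ = _ := by simp

end Balanced

/-! ### Recovery with high probability -/

section Events

variable {n k : ℕ}

theorem mem_agreementEvent {x : Edges n} {z₀ : Labels n k} {κ δ : ℝ}
    (hgap : HasLikelihoodGap (adjacency x) z₀ κ) (hδ : 0 < δ) (hδ1 : δ ≤ 1) (hn : 16 ≤ δ * n)
    (hnk : 2 * k < n) (hbal : IsBalanced δ z₀)
    (hκ₁ : 32 * Real.log (1 / δ) / δ ^ 2 < κ)
    (hκ₂ : k * (1 / δ + Real.log (1 / δ)) + 2 + 2 * Real.log n ≤ κ * δ / 4) (hκ : 0 < κ)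
    (hemp : empiricalQ (adjacency x) z₀ ∈ connectionSpace k) :
    (z₀, x) ∈ agreementEvent n k := by
  refine ⟨hgap.exists_isVariationalLabels hδ hδ1 hn hnk hbal hκ₁ hκ₂ hemp,
    ⟨z₀, _, hgap.isMLE hκ.le hemp⟩, fun zVar zMle hVar hMle => ?_⟩
  obtain ⟨σ, rfl⟩ := hgap.eq_perm_comp_of_isVariationalLabels hδ hδ1 hn hnk hbal hκ₁ hκ₂ hemp hVar
  obtain ⟨τ, rfl⟩ := hgap.eq_perm_comp_of_isMLELabels hκ hemp hMle
  exact ⟨σ * τ⁻¹, fun i => by simp⟩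

theorem mem_errorEvent {x : Edges n} {z₀ : Labels n k} {κ δ r : ℝ}
    {Q : Matrix (Fin k) (Fin k) ℝ}
    (hgap : HasLikelihoodGap (adjacency x) z₀ κ) (hδ : 0 < δ) (hδ1 : δ ≤ 1) (hn : 16 ≤ δ * n)
    (hnk : 2 * k < n) (hbal : IsBalanced δ z₀)
    (hκ₁ : 32 * Real.log (1 / δ) / δ ^ 2 < κ)
    (hκ₂ : k * (1 / δ + Real.log (1 / δ)) + 2 + 2 * Real.log n ≤ κ * δ / 4)
    (hemp : empiricalQ (adjacency x) z₀ ∈ connectionSpace k)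
    (hr : frobeniusSq (theta z₀ Q - thetaHat (adjacency x) z₀) ≤ r) :
    (z₀, x) ∈ errorEvent n Q r := by
  refine ⟨hgap.exists_isVariationalLabels hδ hδ1 hn hnk hbal hκ₁ hκ₂ hemp, fun z hz => ?_⟩
  obtain ⟨σ, rfl⟩ := hgap.eq_perm_comp_of_isVariationalLabels hδ hδ1 hn hnk hbal hκ₁ hκ₂ hemp hz
  rw [thetaHat_perm_comp]
  exact hr

end Events

/-! ### Convergence of probabilities and constants of the model. -/

theorem tendsto_measure_one_of_compl_le {Ω : ℕ → Type*} [∀ n, MeasurableSpace (Ω n)]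
    [∀ n, DiscreteMeasurableSpace (Ω n)] {μ : ∀ n, Measure (Ω n)}
    (hμ : ∀ n, IsProbabilityMeasure (μ n)) {S : ∀ n, Set (Ω n)} {u : ℕ → ENNReal}
    (hu : Tendsto u atTop (𝓝 0)) (h : ∀ᶠ n in atTop, μ n (S n)ᶜ ≤ u n) :
    Tendsto (fun n => μ n (S n)) atTop (𝓝 1) := by
  have h1 : Tendsto (fun n => 1 - u n) atTop (𝓝 1) := by
    simpa using ENNReal.Tendsto.sub (tendsto_const_nhds (x := (1 : ENNReal))) hu
      (Or.inl ENNReal.one_ne_top)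
  refine tendsto_of_tendsto_of_tendsto_of_le_of_le' h1 tendsto_const_nhds ?_
    (Eventually.of_forall fun n => prob_le_one)
  filter_upwards [h] with n hn
  have h2 := prob_compl_eq_one_sub (μ := μ n) (s := (S n)ᶜ) (MeasurableSet.of_discrete)
  rw [compl_compl] at h2
  rw [h2]
  exact tsub_le_tsub_left hn 1

theorem exists_pos_forall_le {ι : Type*} [Finite ι] {f : ι → ℝ} (hf : ∀ i, 0 < f i) :
    ∃ c, 0 < c ∧ ∀ i, c ≤ f i := by
  rcases isEmpty_or_nonempty ι with h | h
  · exact ⟨1, one_pos, fun i => h.elim i⟩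
  · obtain ⟨i, hi⟩ := Finite.exists_min f
    exact ⟨f i, hf i, hi⟩

/-- Symmetry turns distinct columns into distinct rows, the square root is injective on positive
numbers, and there are finitely many pairs. -/
theorem exists_separation {k : ℕ} {Q : Matrix (Fin k) (Fin k) ℝ} (hsymm : Q.IsSymm)
    (hpos : ∀ a b, 0 < Q a b) (hcol : ∀ a b, a ≠ b → ∃ c, Q c a ≠ Q c b) :
    ∃ γ, 0 < γ ∧ ∀ a b, a ≠ b → ∃ c, γ ≤ (√(Q a c) - √(Q b c)) ^ 2 := by
  have h : ∀ p : {p : Fin k × Fin k // p.1 ≠ p.2}, ∃ c,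
      0 < (√(Q p.1.1 c) - √(Q p.1.2 c)) ^ 2 := by
    intro p
    obtain ⟨c, hc⟩ := hcol _ _ p.2
    refine ⟨c, sq_pos_iff.2 ?_⟩
    rw [sub_ne_zero, Ne, Real.sqrt_inj (hpos _ _).le (hpos _ _).le, hsymm.apply c p.1.1,
      hsymm.apply c p.1.2]
    exact hc
  choose c hc using h
  obtain ⟨γ, hγ, hle⟩ := exists_pos_forall_le hc
  exact ⟨γ, hγ, fun a b hab => ⟨c ⟨(a, b), hab⟩, hle ⟨(a, b), hab⟩⟩⟩

/-! ### Asymptotics -/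

section Asymptotics

variable {ρ : ℕ → ℝ}

theorem eventually_mul_log_le
    (hρ : Tendsto (fun n : ℕ => ρ n / (Real.log n / n)) atTop atTop) (M : ℝ) :
    ∀ᶠ n : ℕ in atTop, M * Real.log n ≤ ρ n * n := by
  filter_upwards [hρ.eventually_ge_atTop M, eventually_ge_atTop 2] with n h1 h2
  have hn : (0 : ℝ) < n := by positivity
  have hlog : 0 < Real.log n := Real.log_pos (by exact_mod_cast h2)
  rw [le_div_iff₀ (by positivity), ← mul_div_assoc, div_le_iff₀ hn] at h1
  exact h1

theorem tendsto_log_natCast : Tendsto (fun n : ℕ => Real.log n) atTop atTop :=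
  Real.tendsto_log_atTop.comp tendsto_natCast_atTop_atTop

theorem tendsto_mul_natCast
    (hρ : Tendsto (fun n : ℕ => ρ n / (Real.log n / n)) atTop atTop) :
    Tendsto (fun n : ℕ => ρ n * n) atTop atTop := by
  refine tendsto_atTop_mono' atTop ?_ tendsto_log_natCast
  filter_upwards [eventually_mul_log_le hρ 1] with n hn
  linarith

theorem tendsto_balance_bound {δ : ℝ} (hδ : 0 < δ) (k : ℕ) :
    Tendsto (fun n : ℕ => ENNReal.ofReal (k * Real.exp (-(δ / 5 * n)))) atTop (𝓝 0) := by
  rw [← ENNReal.ofReal_zero]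
  refine ENNReal.tendsto_ofReal ?_
  have h1 : Tendsto (fun n : ℕ => δ / 5 * (n : ℝ)) atTop atTop :=
    tendsto_natCast_atTop_atTop.const_mul_atTop (by positivity)
  simpa using (Real.tendsto_exp_neg_atTop_nhds_zero.comp h1).const_mul (k : ℝ)

theorem tendsto_gap_bound (C : ℝ) :
    Tendsto (fun n : ℕ => ENNReal.ofReal (C / n)) atTop (𝓝 0) := by
  rw [← ENNReal.ofReal_zero]
  exact ENNReal.tendsto_ofReal (tendsto_const_div_atTop_nhds_zero_nat C)

theorem tendsto_interior_bound
    (hρ : Tendsto (fun n : ℕ => ρ n / (Real.log n / n)) atTop atTop) {δ q c : ℝ} (hδ : 0 < δ)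
    (hq : 0 < q) (hc : c < 1) (k : ℕ) :
    Tendsto (fun n : ℕ => ENNReal.ofReal (k ^ 2 * (2 / (δ ^ 2 * n ^ 2 / 2 * (ρ n * q))
      + 2 / (δ ^ 2 * n ^ 2 / 2 * (1 - c) ^ 2)))) atTop (𝓝 0) := by
  have hn : Tendsto (fun n : ℕ => (n : ℝ)) atTop atTop := tendsto_natCast_atTop_atTop
  have h1 : Tendsto (fun n : ℕ => δ ^ 2 * (n : ℝ) ^ 2 / 2 * (ρ n * q)) atTop atTop := by
    have h := ((tendsto_mul_natCast hρ).atTop_mul_atTop₀ hn).const_mul_atTop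
      (show 0 < δ ^ 2 / 2 * q by positivity)
    refine h.congr fun n => by ring
  have h2 : Tendsto (fun n : ℕ => δ ^ 2 * (n : ℝ) ^ 2 / 2 * (1 - c) ^ 2) atTop atTop := by
    have hc' : 0 < 1 - c := by linarith
    have h := (hn.atTop_mul_atTop₀ hn).const_mul_atTop
      (show 0 < δ ^ 2 / 2 * (1 - c) ^ 2 by positivity)
    refine h.congr fun n => by ring
  rw [← ENNReal.ofReal_zero]
  refine ENNReal.tendsto_ofReal ?_
  simpa using ((h1.const_div_atTop 2).add (h2.const_div_atTop 2)).const_mul ((k : ℝ) ^ 2)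

theorem tendsto_error_bound {k : ℕ} (hk : 2 ≤ k) (q : ℝ) :
    Tendsto (fun n : ℕ => ENNReal.ofReal (2 * (k : ℝ) ^ 2 * q / ((k : ℝ) ^ 2 + n * Real.log k)))
      atTop (𝓝 0) := by
  have hlog : 0 < Real.log k := Real.log_pos (by exact_mod_cast hk)
  have h1 : Tendsto (fun n : ℕ => (k : ℝ) ^ 2 + n * Real.log k) atTop atTop :=
    tendsto_atTop_add_const_left _ _ (tendsto_natCast_atTop_atTop.atTop_mul_const hlog)
  rw [← ENNReal.ofReal_zero]
  exact ENNReal.tendsto_ofReal (h1.const_div_atTop _)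

/-- The conditions on the size of the likelihood gap hold eventually. -/
theorem eventually_gap_conditions
    (hρ : Tendsto (fun n : ℕ => ρ n / (Real.log n / n)) atTop atTop) {c δ : ℝ} (hc : 0 < c)
    (hδ : 0 < δ) (k : ℕ) :
    ∀ᶠ n : ℕ in atTop, 0 < c * (ρ n * n) ∧ 32 * Real.log (1 / δ) / δ ^ 2 < c * (ρ n * n)
      ∧ k * (1 / δ + Real.log (1 / δ)) + 2 + 2 * Real.log n ≤ c * (ρ n * n) * δ / 4
      ∧ (4 * k ^ 2 + 2) * Real.log n ≤ c * (ρ n * n) / 2 := by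
  have h1 := (tendsto_mul_natCast hρ).const_mul_atTop hc
  filter_upwards [h1.eventually_gt_atTop 0,
    h1.eventually_gt_atTop (32 * Real.log (1 / δ) / δ ^ 2),
    tendsto_log_natCast.eventually_ge_atTop (k * (1 / δ + Real.log (1 / δ)) + 2),
    -- The constant terms are eventually at most `log n`, so `3 * log n` must fit below a quarter of
    -- `κ * δ`; hence the `12`.
    eventually_mul_log_le hρ (12 / (δ * c)),
    eventually_mul_log_le hρ ((4 * k ^ 2 + 2) * 2 / c)] with n h2 h3 h4 h5 h6
  refine ⟨h2, h3, ?_, ?_⟩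
  · rw [div_mul_eq_mul_div, div_le_iff₀ (by positivity)] at h5
    linarith
  · rw [div_mul_eq_mul_div, div_le_iff₀ hc] at h6
    linarith

end Asymptotics

end SBM

/-! ### Assembly of the theorem. -/

theorem theorem3 (k : ℕ) (hk : 2 ≤ k) (Q₀ : Matrix (Fin k) (Fin k) ℝ)
    (hQ₀_symm : Q₀.IsSymm) (hQ₀_pos : ∀ a b, 0 < Q₀ a b)
    (hQ₀_col : ∀ a b, a ≠ b → ∃ c, Q₀ c a ≠ Q₀ c b) :
    ∃ C : ℝ, 0 < C ∧
      ∀ (α₀ : Fin k → ℝ) (ρ : ℕ → ℝ),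
        (∀ a, 0 < α₀ a) → ∑ a, α₀ a = 1 →
        ∑ a, ∑ b, α₀ a * α₀ b * Q₀ a b = 1 →
        (∀ n, 0 < ρ n) →
        (∃ c : ℝ, c < 1 ∧ ∀ n a b, ρ n * Q₀ a b ≤ c) →
        Tendsto (fun n : ℕ => ρ n / (Real.log n / n)) atTop atTop →
        Tendsto (fun n : ℕ => SBM.sbmLaw n α₀ (ρ n • Q₀) (SBM.agreementEvent n k))
          atTop (𝓝 1) ∧
        Tendsto (fun n : ℕ => SBM.sbmLaw n α₀ (ρ n • Q₀)
            (SBM.errorEvent n (ρ n • Q₀) (C * (ρ n * ((k : ℝ) ^ 2 + n * Real.log k)))))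
          atTop (𝓝 1) := by
  open SBM in
  -- The constant `1` works for every `Q₀`: the expected error with the true labels is of order `k ^
  -- 2 * ρ n`, while the threshold has the additional term `ρ n * n * log k`, which tends to
  -- infinity relative to it.
  refine ⟨1, one_pos, fun α ρ hα hα_sum _ hρ_pos ⟨c, hc, hρc⟩ hρ => ?_⟩
  have hα' : α ∈ stdSimplex ℝ (Fin k) := ⟨fun a => (hα a).le, hα_sum⟩
  obtain ⟨m, hm, hmα⟩ := exists_pos_forall_le hα
  obtain ⟨δ, hδ, hδ1, hδα⟩ : ∃ δ : ℝ, 0 < δ ∧ δ ≤ 1 ∧ ∀ a, 2 * δ ≤ α a := by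
    refine ⟨m / 2, by linarith, ?_, fun a => by linarith [hmα a]⟩
    linarith [hmα ⟨0, by omega⟩, le_one_of_mem_stdSimplex hα' ⟨0, by omega⟩]
  obtain ⟨q₁, hq₁, hq₁Q⟩ := exists_pos_forall_le (f := fun p : Fin k × Fin k => Q₀ p.1 p.2)
    fun p => hQ₀_pos _ _
  obtain ⟨q₂, hq₂Q⟩ := (Set.finite_range fun p : Fin k × Fin k => Q₀ p.1 p.2).bddAbove
  obtain ⟨γ, hγ, hsep⟩ := exists_separation hQ₀_symm hQ₀_pos hQ₀_col
  have hQ : ∀ n, ρ n • Q₀ ∈ connectionSpace k := fun n =>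
    ⟨hQ₀_symm.smul _, fun a b => ⟨mul_pos (hρ_pos n) (hQ₀_pos a b), (hρc n a b).trans_lt hc⟩⟩
  -- Scaling by `ρ n` multiplies square roots by `√(ρ n)`, so the squared separation is exactly
  -- linear in `ρ n`.
  have hsep_n : ∀ n a b, a ≠ b →
      ∃ c, ρ n * γ ≤ (√((ρ n • Q₀) a c) - √((ρ n • Q₀) b c)) ^ 2 := by
    intro n a b hab
    obtain ⟨c, hc⟩ := hsep a b hab
    refine ⟨c, ?_⟩
    simp only [Matrix.smul_apply, smul_eq_mul]
    rw [Real.sqrt_mul (hρ_pos n).le, Real.sqrt_mul (hρ_pos n).le, ← mul_sub, mul_pow,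
      Real.sq_sqrt (hρ_pos n).le]
    exact mul_le_mul_of_nonneg_left hc (hρ_pos n).le
  set κ : ℕ → ℝ := fun n => γ * δ ^ 2 / 32 * (ρ n * n) with hκ
  have hδn : ∀ᶠ n : ℕ in atTop, 16 ≤ δ * n :=
    (tendsto_natCast_atTop_atTop.const_mul_atTop hδ).eventually_ge_atTop 16
  -- The four failure probabilities: unbalanced labels, no likelihood gap, empirical matrix on the
  -- boundary, and a large error with the true labels. The last one matters only for the error
  -- event.
  set u₁ : ℕ → ENNReal := fun n => ENNReal.ofReal (k * Real.exp (-(δ / 5 * n)))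
  set u₂ : ℕ → ENNReal := fun n =>
    ENNReal.ofReal (2 ^ (2 * k ^ 2) * k.factorial * (2 * k) / n)
  set u₃ : ℕ → ENNReal := fun n => ENNReal.ofReal (k ^ 2 * (2 / (δ ^ 2 * n ^ 2 / 2 * (ρ n * q₁))
      + 2 / (δ ^ 2 * n ^ 2 / 2 * (1 - c) ^ 2)))
  set u₄ : ℕ → ENNReal := fun n =>
    ENNReal.ofReal (2 * (k : ℝ) ^ 2 * q₂ / ((k : ℝ) ^ 2 + n * Real.log k))
  have hu₁ : Tendsto u₁ atTop (𝓝 0) := tendsto_balance_bound hδ k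
  have hu₂ : Tendsto u₂ atTop (𝓝 0) := tendsto_gap_bound _
  have hu₃ : Tendsto u₃ atTop (𝓝 0) := tendsto_interior_bound hρ hδ hq₁ hc k
  have hu₄ : Tendsto u₄ atTop (𝓝 0) := tendsto_error_bound hk q₂
  have hgap : ∀ᶠ n : ℕ in atTop, ∀ z : Labels n k, IsBalanced δ z →
      edgesLaw (ρ n • Q₀) z {x | ¬ HasLikelihoodGap (adjacency x) z (κ n)} ≤ u₂ n := by
    filter_upwards [eventually_gap_conditions hρ (show 0 < γ * δ ^ 2 / 32 by positivity) hδ k,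
      hδn, eventually_ge_atTop k] with n h1 h2 h3 z hz
    refine (edgesLaw_not_hasLikelihoodGap_le (hQ n) (mul_pos (hρ_pos n) hγ) hδ hδ1 (hsep_n n)
      (by linarith) hz (by rw [hκ]; ring)).trans (ENNReal.ofReal_le_ofReal ?_)
    exact grid_union_bound_le (by omega) h3 h1.2.2.2
  have hemp : ∀ᶠ n : ℕ in atTop, ∀ z : Labels n k, IsBalanced δ z →
      edgesLaw (ρ n • Q₀) z {x | empiricalQ (adjacency x) z ∉ connectionSpace k} ≤ u₃ n := by
    filter_upwards [hδn, eventually_gt_atTop 0] with n h1 h2 z hz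
    have hn : (0 : ℝ) < n := by exact_mod_cast h2
    exact edgesLaw_empiricalQ_notMem_le (hQ n) (mul_pos (hρ_pos n) hq₁)
      (fun a b => mul_le_mul_of_nonneg_left (hq₁Q (a, b)) (hρ_pos n).le) hc (hρc n)
      (by positivity) fun a b => le_card_block (by linarith) hz a b
  have herr : ∀ n, ∀ z : Labels n k, edgesLaw (ρ n • Q₀) z
      {x | ρ n * ((k : ℝ) ^ 2 + n * Real.log k)
        < frobeniusSq (theta z (ρ n • Q₀) - thetaHat (adjacency x) z)} ≤ u₄ n := by
    intro n z
    have hlog : 0 ≤ Real.log k := Real.log_natCast_nonneg k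
    have hk0 : (0 : ℝ) < k := by exact_mod_cast (by omega : 0 < k)
    refine (edgesLaw_lt_frobeniusSq_le (hQ n) (q := ρ n * q₂)
      (fun a b => mul_le_mul_of_nonneg_left (hq₂Q ⟨(a, b), rfl⟩) (hρ_pos n).le)
      (mul_pos (hρ_pos n) (by positivity)) z).trans (ENNReal.ofReal_le_ofReal (le_of_eq ?_))
    have := (hρ_pos n).ne'
    have : (k : ℝ) ^ 2 + n * Real.log k ≠ 0 := by positivity
    field_simp
  have hprob : ∀ n, IsProbabilityMeasure (sbmLaw n α (ρ n • Q₀)) :=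
    fun n => isProbabilityMeasure_sbmLaw n hα' _
  have hbal : ∀ n, labelsLaw n α {z | IsBalanced δ z}ᶜ ≤ u₁ n :=
    fun n => labelsLaw_not_isBalanced_le hα' hδα
  constructor
  · refine tendsto_measure_one_of_compl_le hprob (u := fun n => u₁ n + (u₂ n + u₃ n))
      (by simpa using hu₁.add (hu₂.add hu₃)) ?_
    filter_upwards [eventually_gap_conditions hρ (show 0 < γ * δ ^ 2 / 32 by positivity) hδ k,
      hδn, eventually_gt_atTop (2 * k), hgap, hemp] with n h1 h2 h3 h4 h5
    refine (sbmLaw_le_add hα' _ (G := {z | IsBalanced δ z}) fun z hz => ?_).trans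
      (add_le_add_left (hbal n) _)
    refine (measure_mono fun x hx => ?_).trans
      ((measure_union_le _ _).trans (add_le_add (h4 z hz) (h5 z hz)))
    by_contra hcon
    simp only [Set.mem_union, Set.mem_ofPred_eq, not_or, not_not] at hcon
    exact hx (mem_agreementEvent hcon.1 hδ hδ1 h2 h3 hz h1.2.1 h1.2.2.1 h1.1 hcon.2)
  · refine tendsto_measure_one_of_compl_le hprob (u := fun n => u₁ n + (u₂ n + u₃ n + u₄ n))
      (by simpa using hu₁.add ((hu₂.add hu₃).add hu₄)) ?_
    filter_upwards [eventually_gap_conditions hρ (show 0 < γ * δ ^ 2 / 32 by positivity) hδ k,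
      hδn, eventually_gt_atTop (2 * k), hgap, hemp] with n h1 h2 h3 h4 h5
    refine (sbmLaw_le_add hα' _ (G := {z | IsBalanced δ z}) fun z hz => ?_).trans
      (add_le_add_left (hbal n) _)
    refine (measure_mono fun x hx => ?_).trans ((measure_union_le _ _).trans (add_le_add
      ((measure_union_le _ _).trans (add_le_add (h4 z hz) (h5 z hz))) (herr n z)))
    by_contra hcon
    simp only [Set.mem_union, Set.mem_ofPred_eq, not_or, not_not, not_lt] at hcon
    exact hx (mem_errorEvent hcon.1.1 hδ hδ1 h2 h3 hz h1.2.1 h1.2.2.1 hcon.1.2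
      (by rw [one_mul]; exact hcon.2))
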